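/- Let $\mathrm{PVAR}$ be a countably infinite set of program variables and $\mathrm{LOC}$ a countably infinite set of locations. Formulae of quantifier-free separation logic $\mathrm{SL}(*,-\!\!*)$ are given by $$\varphi ::= x = y \mid x \hookrightarrow y \mid \mathsf{emp} \mid \neg\varphi \mid \varphi\wedge\varphi \mid \varphi * \varphi \mid \varphi \mathrel{-\!\!*} \varphi \qquad (x,y\in\mathrm{PVAR}).$$ A memory state is a pair $(s,h)$ of a store $s:\mathrm{PVAR}\to\mathrm{LOC}$ and a heap $h$, i.e. a partial function from $\mathrm{LOC}$ to $\mathrm{LOC}$ with finite domain. Heaps are disjoint if their domains are, and $h_1+h_2$ is then the union of their graphs. Satisfaction is classical for $\neg,\wedge$, and: $(s,h)\models x=y$ iff $s(x)=s(y)$; $(s,h)\models x\hookrightarrow y$ iff $s(x)\in\mathrm{dom}(h)$ and $h(s(x))=s(y)$; $(s,h)\models\mathsf{emp}$ iff $\mathrm{dom}(h)=\emptyset$; $(s,h)\models\varphi*\psi$ iff there are disjoint $h_1,h_2$ with $h_1+h_2=h$, $(s,h_1)\models\varphi$ and $(s,h_2)\models\psi$; $(s,h)\models\varphi\mathrel{-\!\!*}\psi$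 iff for every $h_1$ disjoint from $h$ with $(s,h_1)\models\varphi$ we have $(s,h+h_1)\models\psi$. A formula is valid if all memory states satisfy it. Abbreviations: $\vee,\Rightarrow,\Leftrightarrow$ as usual; $x\neq y$ is $\neg(x=y)$; $\bot$ is $x_0\neq x_0$ for a fixed variable $x_0$; $\top$ is $\neg\bot$; $\varphi\circledast\psi$ (septraction) is $\neg(\varphi\mathrel{-\!\!*}\neg\psi)$; $\mathsf{alloc}(x)$ is $(x\hookrightarrow x)\mathrel{-\!\!*}\bot$; $\mathsf{size}\geq 0$ is $\top$, $\mathsf{size}\geq 1$ is $\neg\mathsf{emp}$, $\mathsf{size}\geq\beta$ is $\neg\mathsf{emp}*(\mathsf{size}\geq\beta-1)$ for $\beta\geq2$; $\mathsf{size}=\beta$ is $\mathsf{size}\geq\beta\wedge\neg(\mathsf{size}\geq\beta+1)$. We write $a\mathbin{\dot-}b=\max(0,a-b)$, and $\varphi[y\leftarrow x]$ for $\varphi$ with every occurrence of $y$ replaced by $x$. The Hilbert-style proof system $\mathcal H_C(*,-\!\!*)$ has the following axioms, for all formulae $\varphi,\psi,\chi$, variables $x,y,z$, naturals $\beta_1,\beta_2$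 and finite sets $X\subseteq\mathrm{PVAR}$: * the axiom schemata of propositional calculus, namely $\varphi\Rightarrow(\psi\Rightarrow\varphi)$, $(\varphi\Rightarrow(\psi\Rightarrow\chi))\Rightarrow((\varphi\Rightarrow\psi)\Rightarrow(\varphi\Rightarrow\chi))$, $(\neg\varphi\Rightarrow\neg\psi)\Rightarrow(\psi\Rightarrow\varphi)$, $\varphi\wedge\psi\Rightarrow\varphi$, $\varphi\wedge\psi\Rightarrow\psi$, $\varphi\Rightarrow(\psi\Rightarrow\varphi\wedge\psi)$; * $x=x$; $\ \varphi\wedge x=y\Rightarrow\varphi[y\leftarrow x]$; $\ x\hookrightarrow y\Rightarrow\mathsf{alloc}(x)$; $\ x\hookrightarrow y\wedge x\hookrightarrow z\Rightarrow y=z$; * $\varphi*\psi\Leftrightarrow\psi*\varphi$; $\ (\varphi*\psi)*\chi\Leftrightarrow\varphi*(\psi*\chi)$; $\ \varphi\Leftrightarrow\varphi*\mathsf{emp}$; $\ \mathsf{alloc}(x)*\mathsf{alloc}(x)\Leftrightarrow\bot$; * $e*\top\Rightarrow e$ for $e\in\{\neg\mathsf{emp},\ x=y,\ x\neq y,\ x\hookrightarrow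 y\}$; $\ \neg\mathsf{alloc}(x)*\neg\mathsf{alloc}(x)\Rightarrow\neg\mathsf{alloc}(x)$; $\ (\mathsf{alloc}(x)\wedge\neg x\hookrightarrow y)*\top\Rightarrow\neg x\hookrightarrow y$; * $\mathsf{alloc}(x)\Rightarrow(\mathsf{alloc}(x)\wedge\mathsf{size}=1)*\top$; $\ \neg\mathsf{emp}\Rightarrow(\mathsf{size}=1)*\top$; $\ \neg(\mathsf{size}\geq\beta_1)*\neg(\mathsf{size}\geq\beta_2)\Rightarrow\neg(\mathsf{size}\geq\beta_1+\beta_2\mathbin{\dot-}1)$; $\ \mathsf{alloc}(x)\wedge\mathsf{alloc}(y)\wedge x\neq y\Rightarrow\mathsf{size}\geq2$; * $(\mathsf{size}=1\wedge\bigwedge_{x\in X}\neg\mathsf{alloc}(x))\circledast\top$; $\ \neg\mathsf{alloc}(x)\Rightarrow((x\hookrightarrow y\wedge\mathsf{size}=1)\circledast\top)$; $\ \neg\mathsf{alloc}(x)\Rightarrow((\mathsf{alloc}(x)\wedge\mathsf{size}=1\wedge\bigwedge_{y\in X}\neg x\hookrightarrow y)\circledast\top)$; where the empty conjunction is $\top$.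 Its rules are modus ponens and: from $\varphi\Rightarrow\chi$ infer $\varphi*\psi\Rightarrow\chi*\psi$; from $\varphi*\psi\Rightarrow\chi$ infer $\varphi\Rightarrow(\psi\mathrel{-\!\!*}\chi)$; from $\varphi\Rightarrow(\psi\mathrel{-\!\!*}\chi)$ infer $\varphi*\psi\Rightarrow\chi$. The derivable formulae form the least set that contains all the axioms and is closed under the rules. **Theorem.** $\mathcal H_C(*,-\!\!*)$ is sound and complete for $\mathrm{SL}(*,-\!\!*)$: every derivable formula is valid, and every valid formula is derivable. -/

import Mathlib

namespace SepLogic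

/-! ### Memory states -/

/-- A heap: a partial function from locations to locations with finite domain. -/
structure Heap (L : Type*) where
  /-- The underlying partial function; `none` means that the location is not allocated. -/
  val : L → Option L
  /-- The domain is finite. -/
  finite_dom : {l : L | val l ≠ none}.Finite

/-- The domain of a heap. -/
def Heap.dom {L : Type*} (h : Heap L) : Set L := {l : L | h.val l ≠ none}

/-- Two heaps are disjoint if their domains are. -/
def Heap.Disj {L : Type*} (h₁ h₂ : Heap L) : Prop := h₁.dom ∩ h₂.dom = ∅

/-- The composition of two heaps. It is used for disjoint heaps only, where it is
the heap whose graph is the disjoint union of the two graphs. -/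
def Heap.add {L : Type*} (h₁ h₂ : Heap L) : Heap L where
  val l := (h₁.val l).or (h₂.val l)
  finite_dom := by
    refine (h₁.finite_dom.union h₂.finite_dom).subset ?_
    intro l hl
    by_contra hcon
    simp only [Set.mem_union, Set.mem_ofPred_eq, not_or, not_not] at hcon
    exact hl (by simp [hcon.1, hcon.2])

/-! ### Formulae -/

/-- Formulae of quantifier-free separation logic over the set `V` of program variables. -/
inductive Formula (V : Type*) where
  /-- `x = y` -/
  | eq (x y : V) : Formula V
  /-- `x ↪ y` -/
  | pto (x y : V) : Formula V
  /-- the empty-heap constant -/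
  | emp : Formula V
  /-- negation -/
  | neg (φ : Formula V) : Formula V
  /-- conjunction -/
  | and (φ ψ : Formula V) : Formula V
  /-- separating conjunction -/
  | star (φ ψ : Formula V) : Formula V
  /-- separating implication (magic wand) -/
  | wand (φ ψ : Formula V) : Formula V

/-- Satisfaction of a formula in the memory state with store `s` and heap `h`. -/
def Sat {V L : Type*} (s : V → L) : Heap L → Formula V → Prop
  | _, .eq x y => s x = s y
  | h, .pto x y => h.val (s x) = some (s y)
  | h, .emp => h.dom = ∅
  | h, .neg φ => ¬ Sat s h φ
  | h, .and φ ψ => Sat s h φ ∧ Sat s h ψ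
  | h, .star φ ψ => ∃ h₁ h₂ : Heap L, h₁.Disj h₂ ∧ h₁.add h₂ = h ∧ Sat s h₁ φ ∧ Sat s h₂ ψ
  | h, .wand φ ψ => ∀ h₁ : Heap L, h₁.Disj h → Sat s h₁ φ → Sat s (h.add h₁) ψ

/-- Validity: satisfaction in all memory states with locations in `L`. -/
def Valid {V : Type*} (L : Type*) (φ : Formula V) : Prop :=
  ∀ (s : V → L) (h : Heap L), Sat s h φ

/-! ### Abbreviations -/

namespace Formula

/-- Disjunction. -/
def or {V : Type*} (φ ψ : Formula V) : Formula V := neg (and (neg φ) (neg ψ))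

/-- Implication. -/
def imp {V : Type*} (φ ψ : Formula V) : Formula V := neg (and φ (neg ψ))

/-- Equivalence. -/
def iff {V : Type*} (φ ψ : Formula V) : Formula V := and (imp φ ψ) (imp ψ φ)

/-- `x ≠ y` -/
def ne {V : Type*} (x y : V) : Formula V := neg (eq x y)

/-- The contradiction `x ≠ x`, for a fixed variable `x`. -/
def bot {V : Type*} [Inhabited V] : Formula V := ne default default

/-- The negation of the contradiction. -/
def top {V : Type*} [Inhabited V] : Formula V := neg bot

/-- Septraction. -/
def sept {V : Type*} (φ ψ : Formula V) : Formula V := neg (wand φ (neg ψ))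

/-- `alloc x`, that is `(x ↪ x) -∗ ⊥`: the value of `x` is in the domain of the heap. -/
def alloc {V : Type*} [Inhabited V] (x : V) : Formula V := wand (pto x x) bot

/-- `size ≥ β`: the domain of the heap has at least `β` elements. -/
def sizeGe {V : Type*} [Inhabited V] : ℕ → Formula V
  | 0 => top
  | 1 => neg emp
  | n + 2 => star (neg emp) (sizeGe (n + 1))

/-- `size = β` -/
def sizeEq {V : Type*} [Inhabited V] (β : ℕ) : Formula V :=
  and (sizeGe β) (neg (sizeGe (β + 1)))

/-- The conjunction of a list of formulae; the empty conjunction is `⊤`. -/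
def conj {V : Type*} [Inhabited V] : List (Formula V) → Formula V
  | [] => top
  | [φ] => φ
  | φ :: ψ :: l => and φ (conj (ψ :: l))

/-- Application of a map to all the occurrences of variables in a formula. -/
def rename {V : Type*} (f : V → V) : Formula V → Formula V
  | eq x y => eq (f x) (f y)
  | pto x y => pto (f x) (f y)
  | emp => emp
  | neg φ => neg (rename f φ)
  | and φ ψ => and (rename f φ) (rename f ψ)
  | star φ ψ => star (rename f φ) (rename f ψ)
  | wand φ ψ => wand (rename f φ) (rename f ψ)

/-- `φ.subst y x` is `φ[y ← x]`: every occurrence of `y` in `φ` is replaced with `x`. -/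
def subst {V : Type*} [DecidableEq V] (φ : Formula V) (y x : V) : Formula V :=
  rename (fun z => if z = y then x else z) φ

end Formula

/-! ### The proof system -/

open Formula in
/-- Derivability in the Hilbert-style proof system for quantifier-free separation logic. -/
inductive Derivable {V : Type*} [DecidableEq V] [Inhabited V] : Formula V → Prop
  -- propositional calculus
  | pcK (φ ψ : Formula V) : Derivable (imp φ (imp ψ φ))
  | pcS (φ ψ χ : Formula V) :
      Derivable (imp (imp φ (imp ψ χ)) (imp (imp φ ψ) (imp φ χ)))
  | pcContra (φ ψ : Formula V) : Derivable (imp (imp (neg φ) (neg ψ)) (imp ψ φ))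
  | pcAndLeft (φ ψ : Formula V) : Derivable (imp (and φ ψ) φ)
  | pcAndRight (φ ψ : Formula V) : Derivable (imp (and φ ψ) ψ)
  | pcAndIntro (φ ψ : Formula V) : Derivable (imp φ (imp ψ (and φ ψ)))
  | modusPonens {φ ψ : Formula V} : Derivable (imp φ ψ) → Derivable φ → Derivable ψ
  -- core formulae
  | eqRefl (x : V) : Derivable (eq x x)
  | eqSubst (φ : Formula V) (x y : V) : Derivable (imp (and φ (eq x y)) (φ.subst y x))
  | ptoAlloc (x y : V) : Derivable (imp (pto x y) (alloc x))
  | ptoInj (x y z : V) : Derivable (imp (and (pto x y) (pto x z)) (eq y z))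
  -- separating conjunction
  | starComm (φ ψ : Formula V) : Derivable (iff (star φ ψ) (star ψ φ))
  | starAssoc (φ ψ χ : Formula V) :
      Derivable (iff (star (star φ ψ) χ) (star φ (star ψ χ)))
  | starEmp (φ : Formula V) : Derivable (iff φ (star φ emp))
  | starAllocAlloc (x : V) : Derivable (iff (star (alloc x) (alloc x)) bot)
  | starMono (x y : V) (e : Formula V)
      (he : e ∈ ({neg emp, eq x y, ne x y, pto x y} : Set (Formula V))) :
      Derivable (imp (star e top) e)
  | starNotAlloc (x : V) :
      Derivable (imp (star (neg (alloc x)) (neg (alloc x))) (neg (alloc x)))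
  | starNotPto (x y : V) :
      Derivable (imp (star (and (alloc x) (neg (pto x y))) top) (neg (pto x y)))
  | allocSizeOne (x : V) :
      Derivable (imp (alloc x) (star (and (alloc x) (sizeEq 1)) top))
  | notEmpSizeOne : Derivable (imp (neg emp) (star (sizeEq 1) top))
  | starNotSize (β₁ β₂ : ℕ) :
      Derivable (imp (star (neg (sizeGe β₁)) (neg (sizeGe β₂)))
        (neg (sizeGe (β₁ + β₂ - 1))))
  | sizeTwo (x y : V) :
      Derivable (imp (and (and (alloc x) (alloc y)) (ne x y)) (sizeGe 2))
  -- separating implication; a finite set of variables is given by an enumeration of it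
  | septSize (X : List V) (hX : X.Nodup) :
      Derivable (sept (and (sizeEq 1) (conj (X.map fun x => neg (alloc x)))) top)
  | septPto (x y : V) :
      Derivable (imp (neg (alloc x)) (sept (and (pto x y) (sizeEq 1)) top))
  | septAlloc (x : V) (X : List V) (hX : X.Nodup) :
      Derivable (imp (neg (alloc x))
        (sept (and (and (alloc x) (sizeEq 1)) (conj (X.map fun y => neg (pto x y)))) top))
  -- rules for the separating connectives
  | starIntro {φ χ : Formula V} (ψ : Formula V) :
      Derivable (imp φ χ) → Derivable (imp (star φ ψ) (star χ ψ))
  | starAdj {φ ψ χ : Formula V} :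
      Derivable (imp (star φ ψ) χ) → Derivable (imp φ (wand ψ χ))
  | wandAdj {φ ψ χ : Formula V} :
      Derivable (imp φ (wand ψ χ)) → Derivable (imp (star φ ψ) χ)

end SepLogic

/-! Soundness is an induction on derivations; the infinity of `L` supplies the fresh locations that
`septSize` and `septAlloc` ask for.

Completeness is algebra in the Lindenbaum algebra `Lind V`: a Boolean algebra with an ordered
commutative monoid structure (`star`, with unit `emp`) whose residual is the wand, so that
multiplication distributes over joins. A formula is derivable exactly when its class is `⊤`. For a
finite set `X` of variables, a store `s` and a bound `m`, the type `T X s m h` records what `X` can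
see of `(s, h)`: the equalities inside `X`, the cell at each location named by `X`, and the number
of anonymous cells counted up to `m`.

Two facts suffice. Types are exhaustive: an element above all of them is `⊤` (`top_le_of_EqT_le`,
`EqT_le_of_T_le`). And for each store and each formula over `X`, some bound makes every type decide
the formula in agreement with satisfaction (`exists_decides`). A valid formula then lies above all
types.

Deciding goes by induction on the formula. For `star`, a sum of heaps splits at the level of types
once the bound is doubled (`T_le_mul`), and a product of types that meets the type of `h` comes from
an actual splitting of `h` (`exists_split_T_eq`). For `wand`, types of disjoint heaps multiply
(`T_mul_le`), a nonzero product is realised by disjoint heaps (`exists_disj_T_eq`), and the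
septraction axioms allow extension by the type of any disjoint heap (`T_le_sept`). The consistency
of types is never needed: where a product or a meet is `⊥`, the required inequality is trivial. -/

namespace SepLogic

/-! ### Propositional calculus in the proof system -/

namespace Derivable

open Formula

variable {V : Type*} [DecidableEq V] [Inhabited V] {φ ψ χ : Formula V}

theorem imp_of (φ : Formula V) (h : Derivable ψ) : Derivable (imp φ ψ) :=
  modusPonens (pcK _ _) h

theorem imp_mp (h₁ : Derivable (imp φ (imp ψ χ))) (h₂ : Derivable (imp φ ψ)) :
    Derivable (imp φ χ) :=
  modusPonens (modusPonens (pcS _ _ _) h₁) h₂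

theorem imp_self (φ : Formula V) : Derivable (imp φ φ) :=
  imp_mp (pcK φ (imp φ φ)) (pcK _ _)

theorem imp_trans (h₁ : Derivable (imp φ ψ)) (h₂ : Derivable (imp ψ χ)) :
    Derivable (imp φ χ) :=
  imp_mp (imp_of φ h₂) h₁

theorem imp_and_intro (h₁ : Derivable (imp φ ψ)) (h₂ : Derivable (imp φ χ)) :
    Derivable (imp φ (and ψ χ)) :=
  imp_mp (imp_trans h₁ (pcAndIntro _ _)) h₂

theorem uncurry (h : Derivable (imp φ (imp ψ χ))) : Derivable (imp (and φ ψ) χ) :=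
  imp_mp (imp_trans (pcAndLeft _ _) h) (pcAndRight _ _)

theorem curry (h : Derivable (imp (and φ ψ) χ)) : Derivable (imp φ (imp ψ χ)) :=
  imp_trans (pcAndIntro φ ψ) (modusPonens (pcS _ _ _) (imp_of ψ h))

theorem neg_imp (φ ψ : Formula V) : Derivable (imp (neg φ) (imp φ ψ)) :=
  imp_trans (pcK _ _) (pcContra ψ φ)

/-- From `¬¬φ`, ex falso gives `¬φ ⇒ ¬¬¬φ`, and contraposition turns this into `¬¬φ ⇒ φ`; the
premise is then used a second time. -/
theorem neg_neg_imp (φ : Formula V) : Derivable (imp (neg (neg φ)) φ) :=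
  imp_mp (imp_trans (neg_imp (neg φ) (neg (neg (neg φ)))) (pcContra _ _)) (imp_self _)

theorem imp_neg_neg (φ : Formula V) : Derivable (imp φ (neg (neg φ))) :=
  modusPonens (pcContra _ _) (neg_neg_imp _)

theorem contra (h : Derivable (imp φ ψ)) : Derivable (imp (neg ψ) (neg φ)) :=
  modusPonens (pcContra _ _) (imp_trans (neg_neg_imp _) (imp_trans h (imp_neg_neg _)))

theorem contra_left (h : Derivable (imp (neg φ) ψ)) : Derivable (imp (neg ψ) φ) :=
  imp_trans (contra h) (neg_neg_imp _)

theorem bot_imp (φ : Formula V) : Derivable (imp bot φ) :=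
  contra_left (imp_of _ (eqRefl _))

theorem top_intro : Derivable (top : Formula V) :=
  modusPonens (imp_neg_neg _) (eqRefl _)

/-- Since `bot` is the negation of a derivable equation, `¬¬ψ ⇒ bot` contraposes by axiom to an
implication from that equation to `¬ψ`. -/
theorem imp_neg_of_and (h : Derivable (imp (and φ ψ) bot)) : Derivable (imp φ (neg ψ)) :=
  imp_mp (imp_trans (curry h) (imp_trans (curry (imp_mp (pcAndLeft _ _)
    (imp_trans (pcAndRight _ _) (neg_neg_imp ψ)))) (pcContra _ _))) (imp_of _ (eqRefl default))

theorem iff_mp (h : Derivable (Formula.iff φ ψ)) : Derivable (imp φ ψ) :=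
  modusPonens (pcAndLeft _ _) h

theorem iff_mpr (h : Derivable (Formula.iff φ ψ)) : Derivable (imp ψ φ) :=
  modusPonens (pcAndRight _ _) h

theorem star_right (ψ : Formula V) (h : Derivable (imp φ χ)) :
    Derivable (imp (star ψ φ) (star ψ χ)) :=
  imp_trans (iff_mp (starComm _ _)) (imp_trans (starIntro ψ h) (iff_mp (starComm _ _)))

theorem star_mono {φ' ψ' : Formula V} (h₁ : Derivable (imp φ φ')) (h₂ : Derivable (imp ψ ψ')) :
    Derivable (imp (star φ ψ) (star φ' ψ')) :=
  imp_trans (starIntro ψ h₁) (star_right φ' h₂)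

theorem wand_mono {φ' ψ' : Formula V} (h₁ : Derivable (imp φ' φ)) (h₂ : Derivable (imp ψ ψ')) :
    Derivable (imp (wand φ ψ) (wand φ' ψ')) :=
  starAdj (imp_trans (star_right _ h₁) (imp_trans (wandAdj (imp_self _)) h₂))

end Derivable

/-! ### The Lindenbaum algebra -/

section Lindenbaum

open Formula Derivable

variable {V : Type*} [DecidableEq V] [Inhabited V]

variable (V) in
/-- Derivable equivalence of formulae. -/
def provSetoid : Setoid (Formula V) where
  r φ ψ := Derivable (imp φ ψ) ∧ Derivable (imp ψ φ)
  iseqv :=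
    { refl := fun φ => ⟨imp_self φ, imp_self φ⟩
      symm := fun h => ⟨h.2, h.1⟩
      trans := fun h₁ h₂ => ⟨imp_trans h₁.1 h₂.1, imp_trans h₂.2 h₁.2⟩ }

variable (V) in
/-- The algebra of formulae up to derivable equivalence. -/
def Lind : Type _ := Quotient (provSetoid V)

namespace Lind

/-- The class of a formula. -/
def mk (φ : Formula V) : Lind V := Quotient.mk (provSetoid V) φ

theorem ind {p : Lind V → Prop} (h : ∀ φ, p (mk φ)) (a : Lind V) : p a := Quotient.ind h a

instance : PartialOrder (Lind V) where
  le a b := Quotient.liftOn₂ a b (fun φ ψ => Derivable (imp φ ψ)) fun _ _ _ _ h₁ h₂ =>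
    propext ⟨fun h => imp_trans h₁.2 (imp_trans h h₂.1),
      fun h => imp_trans h₁.1 (imp_trans h h₂.2)⟩
  le_refl := ind imp_self
  le_trans a b c := Quotient.inductionOn₃ a b c fun _ _ _ => imp_trans
  le_antisymm a b := Quotient.inductionOn₂ a b fun _ _ h₁ h₂ => Quotient.sound ⟨h₁, h₂⟩

theorem mk_le_mk {φ ψ : Formula V} : mk φ ≤ mk ψ ↔ Derivable (imp φ ψ) := Iff.rfl

instance : HeytingAlgebra (Lind V) where
  sup := Quotient.map₂ Formula.or fun _ _ h₁ _ _ h₂ =>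
    ⟨contra (imp_and_intro (imp_trans (pcAndLeft _ _) (contra h₁.1))
      (imp_trans (pcAndRight _ _) (contra h₂.1))),
     contra (imp_and_intro (imp_trans (pcAndLeft _ _) (contra h₁.2))
      (imp_trans (pcAndRight _ _) (contra h₂.2)))⟩
  inf := Quotient.map₂ Formula.and fun _ _ h₁ _ _ h₂ =>
    ⟨imp_and_intro (imp_trans (pcAndLeft _ _) h₁.1) (imp_trans (pcAndRight _ _) h₂.1),
     imp_and_intro (imp_trans (pcAndLeft _ _) h₁.2) (imp_trans (pcAndRight _ _) h₂.2)⟩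
  top := mk top
  bot := mk bot
  compl := Quotient.map neg fun _ _ h => ⟨contra h.2, contra h.1⟩
  himp := Quotient.map₂ imp fun _ _ h₁ _ _ h₂ =>
    ⟨curry (imp_trans (imp_mp (pcAndLeft _ _) (imp_trans (pcAndRight _ _) h₁.2)) h₂.1),
     curry (imp_trans (imp_mp (pcAndLeft _ _) (imp_trans (pcAndRight _ _) h₁.1)) h₂.2)⟩
  le_sup_left a b := Quotient.inductionOn₂ a b fun _ _ =>
    imp_trans (imp_neg_neg _) (contra (pcAndLeft _ _))
  le_sup_right a b := Quotient.inductionOn₂ a b fun _ _ =>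
    imp_trans (imp_neg_neg _) (contra (pcAndRight _ _))
  sup_le a b c := Quotient.inductionOn₃ a b c fun _ _ _ h₁ h₂ =>
    contra_left (imp_and_intro (contra h₁) (contra h₂))
  inf_le_left a b := Quotient.inductionOn₂ a b fun _ _ => pcAndLeft _ _
  inf_le_right a b := Quotient.inductionOn₂ a b fun _ _ => pcAndRight _ _
  le_inf a b c := Quotient.inductionOn₃ a b c fun _ _ _ => imp_and_intro
  le_top := ind fun _ => imp_of _ top_intro
  bot_le := ind bot_imp
  le_himp_iff a b c := Quotient.inductionOn₃ a b c fun _ _ _ => ⟨uncurry, curry⟩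
  himp_bot := ind fun _ => Quotient.sound
    ⟨imp_neg_of_and (uncurry (imp_self _)), neg_imp _ _⟩

instance : BooleanAlgebra (Lind V) :=
  BooleanAlgebra.ofRegular fun a => ind (p := fun a => aᶜᶜ = a)
    (fun _ => Quotient.sound ⟨neg_neg_imp _, imp_neg_neg _⟩) (a ⊔ aᶜ)

instance : CommMonoid (Lind V) where
  mul := Quotient.map₂ star fun _ _ h₁ _ _ h₂ => ⟨star_mono h₁.1 h₂.1, star_mono h₁.2 h₂.2⟩
  one := mk emp
  mul_assoc a b c := Quotient.inductionOn₃ a b c fun _ _ _ =>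
    Quotient.sound ⟨iff_mp (starAssoc _ _ _), iff_mpr (starAssoc _ _ _)⟩
  mul_comm a b := Quotient.inductionOn₂ a b fun _ _ =>
    Quotient.sound ⟨iff_mp (starComm _ _), iff_mpr (starComm _ _)⟩
  one_mul := ind fun _ => Quotient.sound
    ⟨imp_trans (iff_mp (starComm _ _)) (iff_mpr (starEmp _)),
      imp_trans (iff_mp (starEmp _)) (iff_mp (starComm _ _))⟩
  mul_one := ind fun _ => Quotient.sound ⟨iff_mpr (starEmp _), iff_mp (starEmp _)⟩

instance : IsOrderedMonoid (Lind V) where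
  mul_le_mul_left a b h c := by
    revert h
    exact Quotient.inductionOn₃ a b c fun _ _ _ h => starIntro _ h

/-- The separating implication on classes of formulae. -/
def wand : Lind V → Lind V → Lind V :=
  Quotient.map₂ Formula.wand fun _ _ h₁ _ _ h₂ => ⟨wand_mono h₁.2 h₂.1, wand_mono h₁.1 h₂.2⟩

/-- The septraction on classes of formulae. -/
def sept (a b : Lind V) : Lind V := (wand a bᶜ)ᶜ

theorem mk_neg (φ : Formula V) : mk (neg φ) = (mk φ)ᶜ := rfl
theorem mk_and (φ ψ : Formula V) : mk (and φ ψ) = mk φ ⊓ mk ψ := rfl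
theorem mk_star (φ ψ : Formula V) : mk (star φ ψ) = mk φ * mk ψ := rfl
theorem mk_wand (φ ψ : Formula V) : mk (Formula.wand φ ψ) = wand (mk φ) (mk ψ) := rfl
theorem mk_emp : mk (emp : Formula V) = 1 := rfl
theorem mk_top : mk (top : Formula V) = ⊤ := rfl

theorem mk_eq_top {φ : Formula V} : mk φ = ⊤ ↔ Derivable φ := by
  rw [← top_le_iff, ← mk_top, mk_le_mk]
  exact ⟨fun h => modusPonens h top_intro, imp_of _⟩

theorem mk_conj (l : List (Formula V)) (a : Lind V) :
    a ≤ mk (conj l) ↔ ∀ φ ∈ l, a ≤ mk φ := by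
  induction l with
  | nil => simp [conj, mk_top]
  | cons φ l ih =>
    cases l with
    | nil => simp [conj]
    | cons ψ l => rw [conj, mk_and, le_inf_iff, ih]; simp

theorem le_wand_iff {a b c : Lind V} : a ≤ wand b c ↔ a * b ≤ c :=
  Quotient.inductionOn₃ a b c fun _ _ _ => ⟨wandAdj, starAdj⟩

end Lind

end Lindenbaum

namespace Lind

variable {V : Type*} [DecidableEq V] [Inhabited V] {a b c d q : Lind V}

/-! ### Residuation and septraction -/

theorem wand_mul_le (a b : Lind V) : wand a b * a ≤ b := le_wand_iff.1 le_rfl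

theorem bot_mul (a : Lind V) : ⊥ * a = ⊥ := le_bot_iff.1 (le_wand_iff.1 bot_le)

theorem mul_bot (a : Lind V) : a * ⊥ = ⊥ := by rw [mul_comm, bot_mul]

theorem sup_mul_le (h₁ : a * c ≤ q) (h₂ : b * c ≤ q) : (a ⊔ b) * c ≤ q :=
  le_wand_iff.1 (sup_le (le_wand_iff.2 h₁) (le_wand_iff.2 h₂))

theorem mul_le_of_split_left (d : Lind V) (h₁ : (d ⊓ a) * b ≤ q) (h₂ : (dᶜ ⊓ a) * b ≤ q) :
    a * b ≤ q := by
  have := sup_mul_le h₁ h₂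
  rwa [← inf_sup_right, sup_compl_eq_top, top_inf_eq] at this

theorem mul_le_of_split_right (d : Lind V) (h₁ : a * (d ⊓ b) ≤ q) (h₂ : a * (dᶜ ⊓ b) ≤ q) :
    a * b ≤ q := by
  rw [mul_comm a] at *
  exact mul_le_of_split_left d h₁ h₂

theorem le_mul_top (a : Lind V) : a ≤ a * ⊤ := by
  simpa using mul_le_mul' (le_refl a) (le_top (a := (1 : Lind V)))

theorem top_mul_top : (⊤ * ⊤ : Lind V) = ⊤ := top_le_iff.1 (le_mul_top _)

theorem sept_top (a : Lind V) : sept a ⊤ = (wand a ⊥)ᶜ := by simp [sept]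

/-- If all extensions by `b` landed in `cᶜ` as well as in `c`, no extension by `b` would exist,
against `h₁`. This separates the existence of an extension from the computation of its result. -/
theorem le_sept (h₁ : a ≤ sept b ⊤) (h₂ : a * b ≤ c) : a ≤ sept b c := by
  rw [sept, le_compl_iff_disjoint_right, disjoint_iff_inf_le]
  have h : a ⊓ wand b cᶜ ≤ wand b ⊥ := by
    rw [le_wand_iff, ← inf_compl_self c]
    exact le_inf ((mul_le_mul' inf_le_left le_rfl).trans h₂)
      ((mul_le_mul' inf_le_right le_rfl).trans (wand_mul_le _ _))
  rw [← compl_inf_self (wand b ⊥), ← sept_top]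
  exact le_inf (inf_le_left.trans h₁) h

theorem sept_mono {b' c' : Lind V} (h₁ : b ≤ b') (h₂ : c ≤ c') : sept b c ≤ sept b' c' := by
  refine compl_le_compl (le_wand_iff.2 ?_)
  exact (mul_le_mul' le_rfl h₁).trans ((wand_mul_le _ _).trans (compl_le_compl h₂))

theorem sept_mul (a b c : Lind V) : sept (a * b) c = sept a (sept b c) := by
  have h : wand (a * b) cᶜ = wand a (wand b cᶜ) := eq_of_forall_le_iff fun x => by
    rw [le_wand_iff, le_wand_iff, le_wand_iff, mul_assoc]
  simp [sept, h]

theorem sept_one (a : Lind V) : sept 1 a = a := by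
  have h : wand 1 aᶜ = aᶜ := eq_of_forall_le_iff fun x => by rw [le_wand_iff, mul_one]
  simp [sept, h]

/-! ### Elements that distribute over the separating conjunction -/

/-- An element is hereditary when it passes to both parts of a separating conjunction. -/
def Hereditary (d : Lind V) : Prop := ∀ a b, d ⊓ (a * b) ≤ (d ⊓ a) * (d ⊓ b)

/-- A failure of `d` in either factor spreads to the whole product, so splitting both factors along
`d` leaves only the case where both satisfy it. -/
theorem hereditary_of_compl (h : dᶜ * ⊤ ≤ dᶜ) : Hereditary d := by
  intro a b
  rw [inf_comm, ← le_himp_iff]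
  have h' : dᶜ ≤ d ⇨ (d ⊓ a) * (d ⊓ b) := by rw [himp_eq]; exact le_sup_right
  refine mul_le_of_split_left d (mul_le_of_split_right d ?_ ?_) ?_
  · rw [himp_eq]; exact le_sup_left
  · rw [mul_comm]
    exact (mul_le_mul' inf_le_left le_top).trans (h.trans h')
  · exact (mul_le_mul' inf_le_left le_top).trans (h.trans h')

theorem Hereditary.inf (hc : Hereditary c) (hd : Hereditary d) : Hereditary (c ⊓ d) := by
  intro a b
  rw [inf_assoc, inf_assoc, inf_assoc]
  exact (inf_le_inf_left _ (hd a b)).trans (hc _ _)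

theorem hereditary_top : Hereditary (⊤ : Lind V) := by simp [Hereditary]

theorem Hereditary.finset_inf {ι : Type*} (s : Finset ι) {f : ι → Lind V}
    (h : ∀ i ∈ s, Hereditary (f i)) : Hereditary (s.inf f) := by
  classical
  induction s using Finset.induction_on with
  | empty => exact hereditary_top
  | insert i s _ ih =>
    rw [Finset.inf_insert]
    exact (h i (by simp)).inf (ih fun j hj => h j (by simp [hj]))

theorem finset_inf_mul_le {ι : Type*} (s : Finset ι) {f : ι → Lind V}
    (h : ∀ i ∈ s, f i * f i ≤ f i) : s.inf f * s.inf f ≤ s.inf f :=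
  Finset.le_inf fun i hi => (mul_le_mul' (Finset.inf_le hi) (Finset.inf_le hi)).trans (h i hi)

theorem finset_inf_mul_top_le {ι : Type*} (s : Finset ι) {f : ι → Lind V}
    (h : ∀ i ∈ s, f i * ⊤ ≤ f i) : s.inf f * ⊤ ≤ s.inf f :=
  Finset.le_inf fun i hi => (mul_le_mul' (Finset.inf_le hi) le_rfl).trans (h i hi)

theorem prod_le_of_mul_le {ι : Type*} (s : Finset ι) {f : ι → Lind V} (h1 : 1 ≤ d)
    (hd : d * d ≤ d) (h : ∀ i ∈ s, f i ≤ d) : ∏ i ∈ s, f i ≤ d := by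
  classical
  induction s using Finset.induction_on with
  | empty => simpa
  | insert i s hi ih =>
    rw [Finset.prod_insert hi]
    exact (mul_le_mul' (h i (by simp)) (ih fun j hj => h j (by simp [hj]))).trans hd

theorem prod_le_of_mem {ι : Type*} {s : Finset ι} {f : ι → Lind V} {i : ι} (hi : i ∈ s)
    (hd : d * ⊤ ≤ d) (h : f i ≤ d) : ∏ i ∈ s, f i ≤ d := by
  classical
  rw [← Finset.mul_prod_erase s f hi]
  exact (mul_le_mul' h le_top).trans hd

/-! ### Classes of the core formulae -/

/-- The class of `x = y`. -/
def E (x y : V) : Lind V := mk (.eq x y)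

/-- The class of `x ↪ y`. -/
def P (x y : V) : Lind V := mk (.pto x y)

/-- The class of `alloc x`. -/
def A (x : V) : Lind V := mk (.alloc x)

variable (V) in
/-- The class of `size ≥ n`. -/
def S (n : ℕ) : Lind V := mk (.sizeGe n)

variable (V) in
/-- The class of `size = n`. -/
def Z (n : ℕ) : Lind V := S V n ⊓ (S V (n + 1))ᶜ

theorem mul_top_le_of_mem {e : Formula V} (x y : V)
    (he : e ∈ ({.neg .emp, .eq x y, .ne x y, .pto x y} : Set (Formula V))) :
    mk e * ⊤ ≤ mk e := Derivable.starMono x y e he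

theorem E_mul_top (x y : V) : E x y * ⊤ ≤ E x y := mul_top_le_of_mem x y (by simp)

theorem E_compl_mul_top (x y : V) : (E x y)ᶜ * ⊤ ≤ (E x y)ᶜ :=
  mul_top_le_of_mem x y (by simp [Formula.ne])

theorem P_mul_top (x y : V) : P x y * ⊤ ≤ P x y := mul_top_le_of_mem x y (by simp)

theorem mk_eq_of_iff {φ ψ : Formula V} (h : Derivable (φ.iff ψ)) : mk φ = mk ψ :=
  Quotient.sound ⟨Derivable.iff_mp h, Derivable.iff_mpr h⟩

theorem E_self (x : V) : E x x = ⊤ := mk_eq_top.2 (.eqRefl x)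

/-- The substitution axiom, applied to `φ` and to `¬ψ`, gives contradictory formulae. All congruence
properties of equality are instances. -/
theorem E_inf_mk_le {φ ψ : Formula V} {x y : V} (h : φ.subst y x = ψ.subst y x) :
    E x y ⊓ mk φ ≤ mk ψ := by
  have h₁ : mk φ ⊓ E x y ≤ mk (φ.subst y x) := Derivable.eqSubst φ x y
  have h₂ : (mk ψ)ᶜ ⊓ E x y ≤ (mk (ψ.subst y x))ᶜ := Derivable.eqSubst ψ.neg x y
  rw [h] at h₁
  rw [← disjoint_compl_right_iff, disjoint_iff_inf_le]
  calc E x y ⊓ mk φ ⊓ (mk ψ)ᶜ ≤ (mk φ ⊓ E x y) ⊓ ((mk ψ)ᶜ ⊓ E x y) :=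
        le_inf (le_inf (inf_le_left.trans inf_le_right) (inf_le_left.trans inf_le_left))
          (le_inf inf_le_right (inf_le_left.trans inf_le_left))
    _ ≤ _ := inf_le_inf h₁ h₂
    _ = ⊥ := inf_compl_self _

theorem E_symm_le (x y : V) : E x y ≤ E y x := by
  have := E_inf_mk_le (φ := .eq x x) (ψ := .eq y x) (x := x) (y := y)
    (by simp [Formula.subst, Formula.rename])
  rwa [show mk (.eq x x) = ⊤ from E_self x, inf_top_eq] at this

theorem E_comm (x y : V) : E x y = E y x := le_antisymm (E_symm_le _ _) (E_symm_le _ _)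

theorem E_trans (x y z : V) : E x y ⊓ E y z ≤ E x z :=
  E_inf_mk_le (by simp [Formula.subst, Formula.rename])

theorem E_inf_A_le (x y : V) : E x y ⊓ A x ≤ A y :=
  E_inf_mk_le (by simp [Formula.subst, Formula.rename, Formula.alloc])

theorem E_inf_P_le_left (x y z : V) : E x y ⊓ P x z ≤ P y z :=
  E_inf_mk_le (by simp [Formula.subst, Formula.rename])

theorem E_inf_P_le_right (x y z : V) : E x y ⊓ P z x ≤ P z y :=
  E_inf_mk_le (by simp [Formula.subst, Formula.rename])

theorem P_inf_P_le (x y z : V) : P x y ⊓ P x z ≤ E y z := Derivable.ptoInj x y z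

theorem P_le_A (x y : V) : P x y ≤ A x := Derivable.ptoAlloc x y

theorem A_mul_A (x : V) : A x * A x = ⊥ := mk_eq_of_iff (.starAllocAlloc x)

theorem A_compl_mul (x : V) : (A x)ᶜ * (A x)ᶜ ≤ (A x)ᶜ := Derivable.starNotAlloc x

theorem A_eq_wand (x : V) : A x = wand (P x x) ⊥ := rfl

theorem A_mul_top (x : V) : A x * ⊤ ≤ A x := by
  rw [A_eq_wand, le_wand_iff, mul_right_comm]
  exact (mul_le_mul' (wand_mul_le _ _) le_rfl).trans (bot_mul _).le

theorem A_inf_P_compl_mul_top (x y : V) : (A x ⊓ (P x y)ᶜ) * ⊤ ≤ (P x y)ᶜ :=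
  Derivable.starNotPto x y

theorem hereditary_A_compl (x : V) : Hereditary (A x)ᶜ :=
  hereditary_of_compl (by rw [compl_compl]; exact A_mul_top x)

theorem hereditary_E (x y : V) : Hereditary (E x y) := hereditary_of_compl (E_compl_mul_top x y)

theorem hereditary_E_compl (x y : V) : Hereditary (E x y)ᶜ :=
  hereditary_of_compl (by rw [compl_compl]; exact E_mul_top x y)

/-! ### Sizes -/

theorem S_zero : S V 0 = ⊤ := rfl

theorem S_one_compl : (S V 1)ᶜ = 1 := by
  rw [show S V 1 = (1 : Lind V)ᶜ from rfl, compl_compl]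

theorem S_one_mul_top : S V 1 * ⊤ = S V 1 :=
  -- The two variables are placeholders: the case used is that of `¬emp`.
  le_antisymm (mul_top_le_of_mem default default (Or.inl rfl)) (le_mul_top _)

theorem S_mul_top (n : ℕ) : S V n * ⊤ = S V n := by
  induction n using Nat.twoStepInduction with
  | zero => exact top_mul_top
  | one => exact S_one_mul_top
  | more n _ ih =>
    rw [show S V (n + 2) = S V 1 * S V (n + 1) from rfl, mul_assoc, ih]

theorem S_succ (n : ℕ) : S V (n + 1) = S V 1 * S V n := by
  cases n with
  | zero => rw [S_zero, S_one_mul_top]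
  | succ n => rfl

theorem S_add (m n : ℕ) : S V (m + n) = S V m * S V n := by
  induction m with
  | zero => rw [Nat.zero_add, S_zero, mul_comm, S_mul_top]
  | succ m ih => rw [Nat.add_right_comm, S_succ, S_succ m, ih, mul_assoc]

theorem S_anti {m n : ℕ} (h : m ≤ n) : S V n ≤ S V m := by
  obtain ⟨k, rfl⟩ := Nat.exists_eq_add_of_le h
  rw [S_add, ← S_mul_top m]
  exact mul_le_mul' (S_mul_top m).le le_top

theorem S_compl_mul (m n : ℕ) : (S V m)ᶜ * (S V n)ᶜ ≤ (S V (m + n - 1))ᶜ :=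
  Derivable.starNotSize m n

theorem S_one_le : S V 1 ≤ Z V 1 * ⊤ := Derivable.notEmpSizeOne

theorem Z_le_S (n : ℕ) : Z V n ≤ S V n := inf_le_left

theorem Z_zero : Z V 0 = 1 := by rw [Z, S_zero, top_inf_eq, S_one_compl]

theorem Z_mul_le (m n : ℕ) : Z V m * Z V n ≤ Z V (m + n) := by
  refine le_inf ?_ ?_
  · rw [S_add]
    exact mul_le_mul' inf_le_left inf_le_left
  · refine (mul_le_mul' inf_le_right inf_le_right).trans ((S_compl_mul _ _).trans ?_)
    rw [show m + 1 + (n + 1) - 1 = m + n + 1 by omega]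

theorem Z_one_pow_le (n : ℕ) : Z V 1 ^ n ≤ Z V n := by
  induction n with
  | zero => rw [pow_zero, Z_zero]
  | succ n ih => rw [pow_succ]; exact (mul_le_mul' ih le_rfl).trans (Z_mul_le _ _)

theorem S_le_Z_one_pow (n : ℕ) : S V n ≤ Z V 1 ^ n * ⊤ := by
  induction n with
  | zero => exact le_top.trans (le_mul_top _) |>.trans (by rw [pow_zero, one_mul, top_mul_top])
  | succ n ih =>
    rw [S_succ, pow_succ', ← top_mul_top, mul_mul_mul_comm]
    exact mul_le_mul' S_one_le ih

/-- A heap of size at least `n` splits off `n` single cells. If the remainder is nonempty the size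
is at least `n + 1`; otherwise nothing but the `n` cells is left. -/
theorem Z_eq_pow (n : ℕ) : Z V n = Z V 1 ^ n := by
  refine le_antisymm ?_ (Z_one_pow_le n)
  have h : Z V 1 ^ n * ⊤ ≤ (S V (n + 1))ᶜ ⇨ Z V 1 ^ n := by
    refine mul_le_of_split_right (S V 1) ?_ ?_
    · rw [himp_eq, compl_compl, S_add]
      exact (mul_le_mul' ((Z_one_pow_le n).trans (Z_le_S n)) inf_le_left).trans le_sup_right
    · rw [inf_top_eq, S_one_compl, mul_one]
      exact le_himp
  exact le_himp_iff.1 ((S_le_Z_one_pow n).trans h)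

theorem Z_add (m n : ℕ) : Z V (m + n) = Z V m * Z V n := by
  rw [Z_eq_pow, pow_add, ← Z_eq_pow, ← Z_eq_pow]

theorem A_le_mul_top (x : V) : A x ≤ (A x ⊓ Z V 1) * ⊤ := Derivable.allocSizeOne x

theorem A_le_S_one (x : V) : A x ≤ S V 1 :=
  (A_le_mul_top x).trans
    ((mul_le_mul' (inf_le_right.trans (Z_le_S 1)) le_rfl).trans (S_mul_top 1).le)

theorem one_le_A_compl (x : V) : 1 ≤ (A x)ᶜ := by
  rw [← S_one_compl]
  exact compl_le_compl (A_le_S_one x)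

theorem A_inf_A_le (x y : V) : A x ⊓ A y ⊓ (E x y)ᶜ ≤ S V 2 := Derivable.sizeTwo x y

/-! ### The sizes up to a bound -/

variable (V) in
/-- The size is `r`, up to the bound `m` beyond which sizes are not distinguished. -/
def Sz (m r : ℕ) : Lind V := if r < m then Z V r else S V m

theorem Sz_of_lt {m r : ℕ} (h : r < m) : Sz V m r = Z V r := if_pos h

theorem Sz_of_le {m r : ℕ} (h : m ≤ r) : Sz V m r = S V m := if_neg (not_lt.2 h)

theorem Sz_le_S (m r : ℕ) : Sz V m r ≤ S V (min m r) := by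
  rcases lt_or_ge r m with h | h
  · rw [Sz_of_lt h, min_eq_right h.le]; exact Z_le_S r
  · rw [Sz_of_le h, min_eq_left h]

theorem Sz_anti {m n : ℕ} (h : m ≤ n) (r : ℕ) : Sz V n r ≤ Sz V m r := by
  rcases lt_or_ge r m with h₁ | h₁
  · rw [Sz_of_lt h₁, Sz_of_lt (h₁.trans_le h)]
  · rw [Sz_of_le h₁]
    exact (Sz_le_S n r).trans (S_anti (le_min h h₁))

theorem Z_le_Sz (m r : ℕ) : Z V r ≤ Sz V m r := by
  rcases lt_or_ge r m with h | h
  · rw [Sz_of_lt h]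
  · rw [Sz_of_le h]; exact (Z_le_S r).trans (S_anti h)

theorem Sz_mul_le (m r₁ r₂ : ℕ) : Sz V m r₁ * Sz V m r₂ ≤ Sz V m (r₁ + r₂) := by
  rcases lt_or_ge (r₁ + r₂) m with h | h
  · rw [Sz_of_lt h, Sz_of_lt (by omega), Sz_of_lt (by omega), Z_add]
  · rw [Sz_of_le h]
    refine (mul_le_mul' (Sz_le_S _ _) (Sz_le_S _ _)).trans ?_
    rw [← S_add]
    exact S_anti (by omega)

theorem S_add_le_Z_mul (m n : ℕ) : S V (m + n) ≤ Z V m * S V n := by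
  rw [S_add, Z_eq_pow, ← S_mul_top n, mul_comm (S V n), ← mul_assoc (Z V 1 ^ m)]
  exact mul_le_mul' (S_le_Z_one_pow m) (by rw [mul_comm, S_mul_top])

/-- This is where the bound doubles: with at least `m + m` cells available, giving fewer than `m` to
one side still leaves `m` for the other. -/
theorem Sz_le_mul (m r₁ r₂ : ℕ) : Sz V (m + m) (r₁ + r₂) ≤ Sz V m r₁ * Sz V m r₂ := by
  rcases lt_or_ge (r₁ + r₂) (m + m) with h | h
  · rw [Sz_of_lt h, Z_add]
    exact mul_le_mul' (Z_le_Sz _ _) (Z_le_Sz _ _)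
  · rw [Sz_of_le h]
    rcases lt_or_ge r₁ m with h₁ | h₁
    · rw [Sz_of_lt h₁, Sz_of_le (r := r₂) (by omega)]
      exact (S_anti (by omega)).trans (S_add_le_Z_mul _ _)
    · rw [Sz_of_le h₁]
      rcases lt_or_ge r₂ m with h₂ | h₂
      · rw [Sz_of_lt h₂, mul_comm]
        exact (S_anti (by omega)).trans (S_add_le_Z_mul _ _)
      · rw [Sz_of_le h₂, S_add]

/-- Downward induction from `S V m`, since `S V k` is covered by `S V (k + 1)` and `Z V k`. -/
theorem top_le_of_Sz_le {m : ℕ} (h : ∀ r, Sz V m r ≤ q) : ⊤ ≤ q := by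
  have key : ∀ k ≤ m, S V k ≤ q := by
    intro k hk
    induction hk using Nat.decreasingInduction with
    | self => rw [← Sz_of_le le_rfl]; exact h m
    | of_succ k hk ih =>
      have hZ := h k
      rw [Sz_of_lt hk] at hZ
      calc S V k = S V k ⊓ S V (k + 1) ⊔ Z V k := by
            rw [Z, ← inf_sup_left, sup_compl_eq_top, inf_top_eq]
        _ ≤ q := sup_le (inf_le_right.trans ih) hZ
  exact key 0 (Nat.zero_le m)

end Lind

/-! ### Heaps -/

namespace Heap

variable {L : Type*} {h h₁ h₂ h₃ : Heap L}

theorem ext (hv : ∀ l, h₁.val l = h₂.val l) : h₁ = h₂ := by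
  cases h₁; cases h₂
  congr
  exact funext hv

theorem mem_dom {l : L} : l ∈ h.dom ↔ h.val l ≠ none := Iff.rfl

theorem dom_finite (h : Heap L) : h.dom.Finite := h.finite_dom

theorem disj_iff : h₁.Disj h₂ ↔ ∀ l, h₁.val l = none ∨ h₂.val l = none := by
  simp only [Disj, Set.eq_empty_iff_forall_notMem, Set.mem_inter_iff, mem_dom, not_and_or, not_not]

theorem Disj.symm (h : h₁.Disj h₂) : h₂.Disj h₁ := by
  rw [disj_iff] at *
  exact fun l => (h l).symm

theorem add_val (h₁ h₂ : Heap L) (l : L) : (h₁.add h₂).val l = (h₁.val l).or (h₂.val l) := rfl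

theorem add_val_eq_none {l : L} :
    (h₁.add h₂).val l = none ↔ h₁.val l = none ∧ h₂.val l = none := by simp [add_val]

theorem add_val_left {l l' : L} (hl : h₁.val l = some l') : (h₁.add h₂).val l = some l' := by
  simp [add_val, hl]

theorem add_comm (hd : h₁.Disj h₂) : h₁.add h₂ = h₂.add h₁ := by
  refine ext fun l => ?_
  rcases disj_iff.1 hd l with h | h <;> simp [add_val, h]

theorem add_assoc (h₁ h₂ h₃ : Heap L) : (h₁.add h₂).add h₃ = h₁.add (h₂.add h₃) :=
  ext fun l => by simp [add_val, Option.or_assoc]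

theorem disj_add_left : (h₁.add h₂).Disj h₃ ↔ h₁.Disj h₃ ∧ h₂.Disj h₃ := by
  simp only [disj_iff, add_val_eq_none]
  grind

theorem disj_add_right : h₃.Disj (h₁.add h₂) ↔ h₃.Disj h₁ ∧ h₃.Disj h₂ := by
  simp only [disj_iff, add_val_eq_none]
  grind

theorem dom_add (h₁ h₂ : Heap L) : (h₁.add h₂).dom = h₁.dom ∪ h₂.dom := by
  ext l
  simp only [mem_dom, Set.mem_union, ne_eq, add_val_eq_none]
  tauto

theorem ncard_dom_add (hd : h₁.Disj h₂) :
    (h₁.add h₂).dom.ncard = h₁.dom.ncard + h₂.dom.ncard := by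
  rw [dom_add, Set.ncard_union_eq (Set.disjoint_iff_inter_eq_empty.2 hd) h₁.dom_finite
    h₂.dom_finite]

theorem add_of_dom_eq_empty (he : h₂.dom = ∅) : h₁.add h₂ = h₁ := by
  refine ext fun l => ?_
  have : h₂.val l = none := by
    by_contra hl
    exact Set.notMem_empty l (he ▸ mem_dom.2 hl)
  simp [add_val, this]

/-- The empty heap. -/
def empty (L : Type*) : Heap L := ⟨fun _ => none, by simp⟩

theorem dom_empty : (empty L).dom = ∅ := by
  ext l
  simp [mem_dom, empty]

open Classical in
/-- The heap with one cell. -/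
noncomputable def single (l l' : L) : Heap L :=
  ⟨fun k => if k = l then some l' else none, (Set.finite_singleton l).subset fun k hk => by
    by_contra hkl
    exact hk (if_neg hkl)⟩

theorem single_val_self (l l' : L) : (single l l').val l = some l' := if_pos rfl

theorem single_val_of_ne {k l : L} (hk : k ≠ l) (l' : L) : (single l l').val k = none := if_neg hk

theorem dom_single (l l' : L) : (single l l').dom = {l} := by
  ext k
  by_cases hk : k = l <;> simp [mem_dom, single, hk]

theorem single_disj {l l' : L} (hl : h.val l = none) : (single l l').Disj h := by
  rw [disj_iff]
  intro k
  by_cases hk : k = l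
  · exact .inr (hk ▸ hl)
  · exact .inl (single_val_of_ne hk l')

open Classical in
/-- The restriction of a heap to a set of locations. -/
noncomputable def restrict (h : Heap L) (p : Set L) : Heap L :=
  ⟨fun l => if l ∈ p then h.val l else none, h.finite_dom.subset fun l hl hn => hl (by simp [hn])⟩

theorem restrict_val_of_mem {p : Set L} {l : L} (hl : l ∈ p) : (h.restrict p).val l = h.val l :=
  if_pos hl

theorem restrict_val_of_notMem {p : Set L} {l : L} (hl : l ∉ p) : (h.restrict p).val l = none :=
  if_neg hl

theorem dom_restrict (h : Heap L) (p : Set L) : (h.restrict p).dom = p ∩ h.dom := by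
  ext l
  by_cases hl : l ∈ p <;> simp [mem_dom, restrict, hl]

theorem restrict_disj (h : Heap L) (p : Set L) : (h.restrict p).Disj (h.restrict pᶜ) := by
  rw [disj_iff]
  intro l
  by_cases hl : l ∈ p
  · exact .inr (restrict_val_of_notMem (by simpa using hl))
  · exact .inl (restrict_val_of_notMem hl)

theorem restrict_add (h : Heap L) (p : Set L) : (h.restrict p).add (h.restrict pᶜ) = h := by
  refine ext fun l => ?_
  by_cases hl : l ∈ p <;> simp [add_val, restrict, hl]

end Heap

/-! ### Satisfaction of the abbreviations -/

section Semantics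

variable {V L : Type*} {s : V → L} {h : Heap L} {φ ψ : Formula V}

theorem sat_imp : Sat s h (.imp φ ψ) ↔ (Sat s h φ → Sat s h ψ) := by
  simp [Formula.imp, Sat]

theorem sat_iff : Sat s h (.iff φ ψ) ↔ (Sat s h φ ↔ Sat s h ψ) := by
  rw [Formula.iff, Sat, sat_imp, sat_imp]
  exact iff_def.symm

theorem sat_sept :
    Sat s h (.sept φ ψ) ↔ ∃ h₁ : Heap L, h₁.Disj h ∧ Sat s h₁ φ ∧ Sat s (h.add h₁) ψ := by
  simp [Formula.sept, Sat]

theorem sat_star : Sat s h (.star φ ψ) ↔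
    ∃ h₁ h₂ : Heap L, h₁.Disj h₂ ∧ h₁.add h₂ = h ∧ Sat s h₁ φ ∧ Sat s h₂ ψ := by
  rw [Sat]

theorem sat_wand :
    Sat s h (.wand φ ψ) ↔ ∀ h₁ : Heap L, h₁.Disj h → Sat s h₁ φ → Sat s (h.add h₁) ψ := by
  rw [Sat]

theorem sat_star_comm : Sat s h (.star φ ψ) → Sat s h (.star ψ φ) := by
  simp only [sat_star]
  rintro ⟨h₁, h₂, hd, rfl, h₁φ, h₂ψ⟩
  exact ⟨h₂, h₁, hd.symm, (Heap.add_comm hd).symm, h₂ψ, h₁φ⟩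

theorem sat_rename (f : V → V) : Sat s h (φ.rename f) ↔ Sat (s ∘ f) h φ := by
  induction φ generalizing h with
  | eq x y => simp [Formula.rename, Sat]
  | pto x y => simp [Formula.rename, Sat]
  | emp => simp [Formula.rename, Sat]
  | neg φ ih => simp [Formula.rename, Sat, ih]
  | and φ ψ ih₁ ih₂ => simp [Formula.rename, Sat, ih₁, ih₂]
  | star φ ψ ih₁ ih₂ => simp [Formula.rename, Sat, ih₁, ih₂]
  | wand φ ψ ih₁ ih₂ => simp [Formula.rename, Sat, ih₁, ih₂]

theorem sat_subst [DecidableEq V] {x y : V} (hxy : s x = s y) :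
    Sat s h (φ.subst y x) ↔ Sat s h φ := by
  rw [Formula.subst, sat_rename]
  congr! 1
  ext z
  by_cases hz : z = y <;> simp [hz, hxy]

theorem sat_emp : Sat s h .emp ↔ h.dom = ∅ := by rw [Sat]

theorem sat_neg : Sat s h (.neg φ) ↔ ¬ Sat s h φ := by rw [Sat]

theorem sat_and : Sat s h (.and φ ψ) ↔ Sat s h φ ∧ Sat s h ψ := by rw [Sat]

theorem sat_pto {x y : V} : Sat s h (.pto x y) ↔ h.val (s x) = some (s y) := by rw [Sat]

theorem sat_eq {x y : V} : Sat s h (.eq x y) ↔ s x = s y := by rw [Sat]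

theorem sat_ne {x y : V} : Sat s h (.ne x y) ↔ s x ≠ s y := by rw [Formula.ne, sat_neg, sat_eq]

variable [Inhabited V]

theorem not_sat_bot : ¬ Sat s h .bot := by simp [Formula.bot, sat_ne]

theorem sat_top : Sat s h .top := by simp [Formula.top, sat_neg, not_sat_bot]

theorem sat_alloc {x : V} : Sat s h (.alloc x) ↔ h.val (s x) ≠ none := by
  simp only [Formula.alloc, sat_wand, not_sat_bot, sat_pto, imp_false]
  constructor
  · intro hx hn
    exact hx (Heap.single (s x) (s x)) (Heap.single_disj hn) (Heap.single_val_self _ _)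
  · intro hx h₁ hd h₁x
    simpa [hx, h₁x] using Heap.disj_iff.1 hd (s x)

theorem sat_not_alloc {x : V} : Sat s h (.neg (.alloc x)) ↔ h.val (s x) = none := by
  rw [sat_neg, sat_alloc, not_not]

theorem sat_sizeGe (n : ℕ) : Sat s h (.sizeGe n) ↔ n ≤ h.dom.ncard := by
  induction n using Nat.twoStepInduction generalizing h with
  | zero => simp [Formula.sizeGe, sat_top]
  | one =>
    rw [Formula.sizeGe, sat_neg, sat_emp, Nat.one_le_iff_ne_zero, ne_eq,
      Set.ncard_eq_zero h.dom_finite]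
  | more n _ ih =>
    rw [Formula.sizeGe, sat_star]
    simp only [sat_neg, sat_emp, ih]
    constructor
    · rintro ⟨h₁, h₂, hd, rfl, h₁e, h₂n⟩
      rw [Heap.ncard_dom_add hd]
      have := Nat.pos_of_ne_zero (mt (Set.ncard_eq_zero h₁.dom_finite).1 h₁e)
      omega
    · intro hn
      obtain ⟨l, hl⟩ := Set.nonempty_of_ncard_ne_zero (s := h.dom) (by omega)
      have h₁ : (h.restrict {l}).dom = {l} := by
        rw [Heap.dom_restrict, Set.inter_eq_left]; exact Set.singleton_subset_iff.2 hl
      have h₂ := Heap.ncard_dom_add (h.restrict_disj {l})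
      rw [Heap.restrict_add, h₁, Set.ncard_singleton] at h₂
      refine ⟨_, _, h.restrict_disj {l}, h.restrict_add {l}, ?_, by omega⟩
      rw [h₁]
      exact Set.singleton_ne_empty l

theorem sat_sizeEq (n : ℕ) : Sat s h (.sizeEq n) ↔ h.dom.ncard = n := by
  rw [Formula.sizeEq, sat_and, sat_neg, sat_sizeGe, sat_sizeGe]
  omega

theorem sat_conj (l : List (Formula V)) : Sat s h (.conj l) ↔ ∀ φ ∈ l, Sat s h φ := by
  induction l with
  | nil => simp [Formula.conj, sat_top]
  | cons φ l ih =>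
    cases l with
    | nil => simp [Formula.conj]
    | cons ψ l => rw [Formula.conj, sat_and, ih]; simp

theorem sat_sizeOne_single (l l' : L) : Sat s (.single l l') (.sizeEq 1) := by
  rw [sat_sizeEq, Heap.dom_single, Set.ncard_singleton]

theorem sat_star_sizeOne {l : L} (hl : h.val l ≠ none)
    (hφ : Sat s (h.restrict {l}) φ) : Sat s h (.star (.and φ (.sizeEq 1)) .top) := by
  refine sat_star.2 ⟨_, _, h.restrict_disj {l}, h.restrict_add {l}, sat_and.2 ⟨hφ, ?_⟩, sat_top⟩
  rw [sat_sizeEq, Heap.dom_restrict, Set.inter_eq_left.2 (Set.singleton_subset_iff.2 hl), Set.ncard_singleton]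

end Semantics

/-! ### Soundness -/

theorem exists_fresh {L : Type*} [Infinite L] {p : Set L} (hp : p.Finite) : ∃ l, l ∉ p :=
  hp.exists_notMem

theorem Derivable.valid {V : Type*} [DecidableEq V] [Inhabited V] {L : Type*} [Infinite L]
    {φ : Formula V} (hφ : Derivable φ) : Valid L φ := by
  classical
  induction hφ with
  | pcK φ ψ => intro s h; simp only [sat_imp]; tauto
  | pcS φ ψ χ => intro s h; simp only [sat_imp]; tauto
  | pcContra φ ψ => intro s h; simp only [sat_imp, sat_neg]; tauto
  | pcAndLeft φ ψ => intro s h; simp only [sat_imp, sat_and]; tauto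
  | pcAndRight φ ψ => intro s h; simp only [sat_imp, sat_and]; tauto
  | pcAndIntro φ ψ => intro s h; simp only [sat_imp, sat_and]; tauto
  | modusPonens _ _ ih₁ ih₂ => exact fun s h => sat_imp.1 (ih₁ s h) (ih₂ s h)
  | eqRefl x => exact fun s h => sat_eq.2 rfl
  | eqSubst φ x y =>
    intro s h
    rw [sat_imp, sat_and, sat_eq]
    exact fun hφ => (sat_subst hφ.2).2 hφ.1
  | ptoAlloc x y =>
    intro s h
    rw [sat_imp, sat_pto, sat_alloc]
    exact fun hx => by simp [hx]
  | ptoInj x y z =>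
    intro s h
    rw [sat_imp, sat_and, sat_pto, sat_pto, sat_eq]
    exact fun hx => Option.some_injective _ (hx.1.symm.trans hx.2)
  | starComm φ ψ => exact fun s h => sat_iff.2 ⟨sat_star_comm, sat_star_comm⟩
  | starAssoc φ ψ χ =>
    intro s h
    simp only [sat_iff, sat_star]
    constructor
    · rintro ⟨_, h₃, hd, rfl, ⟨h₁, h₂, hd', rfl, hs₁, hs₂⟩, hs₃⟩
      rw [Heap.disj_add_left] at hd
      exact ⟨h₁, _, Heap.disj_add_right.2 ⟨hd', hd.1⟩, (Heap.add_assoc _ _ _).symm, hs₁,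
        h₂, h₃, hd.2, rfl, hs₂, hs₃⟩
    · rintro ⟨h₁, _, hd, rfl, hs₁, ⟨h₂, h₃, hd', rfl, hs₂, hs₃⟩⟩
      rw [Heap.disj_add_right] at hd
      exact ⟨_, h₃, Heap.disj_add_left.2 ⟨hd.2, hd'⟩, Heap.add_assoc _ _ _,
        ⟨h₁, h₂, hd.1, rfl, hs₁, hs₂⟩, hs₃⟩
  | starEmp φ =>
    intro s h
    rw [sat_iff, sat_star]
    constructor
    · exact fun hφ => ⟨h, .empty L, Heap.disj_iff.2 fun l => .inr rfl,
        Heap.add_of_dom_eq_empty Heap.dom_empty, hφ, sat_emp.2 Heap.dom_empty⟩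
    · rintro ⟨h₁, h₂, _, rfl, hs₁, hs₂⟩
      rwa [Heap.add_of_dom_eq_empty (sat_emp.1 hs₂)]
  | starAllocAlloc x =>
    intro s h
    simp only [sat_iff, sat_star, not_sat_bot, iff_false, sat_alloc]
    rintro ⟨h₁, h₂, hd, _, hs₁, hs₂⟩
    exact (Heap.disj_iff.1 hd (s x)).elim hs₁ hs₂
  | starMono x y e he =>
    intro s h
    rw [sat_imp, sat_star]
    rintro ⟨h₁, h₂, _, rfl, hs, _⟩
    simp only [Set.mem_insert_iff, Set.mem_singleton_iff] at he
    rcases he with rfl | rfl | rfl | rfl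
    · rw [sat_neg, sat_emp] at *
      rw [Heap.dom_add, Set.union_empty_iff]
      exact fun he => hs he.1
    · exact hs
    · exact sat_ne.2 (sat_ne.1 hs)
    · exact sat_pto.2 (Heap.add_val_left (sat_pto.1 hs))
  | starNotAlloc x =>
    intro s h
    simp only [sat_imp, sat_star, sat_not_alloc]
    rintro ⟨h₁, h₂, _, rfl, hs⟩
    exact Heap.add_val_eq_none.2 hs
  | starNotPto x y =>
    intro s h
    simp only [sat_imp, sat_star, sat_and, sat_neg, sat_alloc, sat_pto]
    rintro ⟨h₁, h₂, _, rfl, hs, _⟩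
    obtain ⟨l, hl⟩ := Option.ne_none_iff_exists'.1 hs.1
    rw [Heap.add_val_left hl, ← hl]
    exact hs.2
  | allocSizeOne x =>
    intro s h
    rw [sat_imp]
    intro hx
    rw [sat_alloc] at hx
    refine sat_star_sizeOne hx ?_
    rwa [sat_alloc, Heap.restrict_val_of_mem (Set.mem_singleton _)]
  | notEmpSizeOne =>
    intro s h
    rw [sat_imp, sat_neg, sat_emp]
    intro he
    obtain ⟨l, hl⟩ := Set.nonempty_iff_ne_empty.2 he
    obtain ⟨h₁, h₂, hd, ha, hs, ht⟩ := sat_star.1 (sat_star_sizeOne (s := s) hl sat_top)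
    exact sat_star.2 ⟨h₁, h₂, hd, ha, (sat_and.1 hs).2, ht⟩
  | starNotSize m n =>
    intro s h
    simp only [sat_imp, sat_star, sat_neg, sat_sizeGe]
    rintro ⟨h₁, h₂, hd, rfl, hs⟩
    rw [Heap.ncard_dom_add hd]
    omega
  | sizeTwo x y =>
    intro s h
    rw [sat_imp, sat_and, sat_and, sat_alloc, sat_alloc, sat_ne, sat_sizeGe]
    rintro ⟨⟨hx, hy⟩, hxy⟩
    rw [← Set.ncard_pair hxy]
    refine Set.ncard_le_ncard (fun l hl => ?_) h.dom_finite
    rcases hl with rfl | rfl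
    · exact hx
    · exact hy
  | septSize X _ =>
    intro s h
    -- The new cell must avoid the heap, to be disjoint from it, and the values of `X`, to allocate
    -- none of them.
    obtain ⟨l, hl⟩ := exists_fresh (h.dom_finite.union (X.map s).finite_toSet)
    simp only [Set.mem_union, Heap.mem_dom, not_or, not_not] at hl
    refine sat_sept.2 ⟨.single l l, Heap.single_disj hl.1, sat_and.2 ⟨sat_sizeOne_single l l, ?_⟩,
      sat_top⟩
    rw [sat_conj]
    simp only [List.mem_map, forall_exists_index, and_imp, forall_apply_eq_imp_iff₂]
    intro x hx
    rw [sat_not_alloc, Heap.single_val_of_ne]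
    rintro rfl
    exact hl.2 (List.mem_map_of_mem hx)
  | septPto x y =>
    intro s h
    rw [sat_imp, sat_not_alloc, sat_sept]
    intro hx
    exact ⟨.single (s x) (s y), Heap.single_disj hx,
      sat_and.2 ⟨sat_pto.2 (Heap.single_val_self _ _), sat_sizeOne_single _ _⟩, sat_top⟩
  | septAlloc x X _ =>
    intro s h
    rw [sat_imp, sat_not_alloc, sat_sept]
    intro hx
    obtain ⟨l, hl⟩ := exists_fresh (X.map s).finite_toSet
    refine ⟨.single (s x) l, Heap.single_disj hx, sat_and.2 ⟨sat_and.2 ⟨?_,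
      sat_sizeOne_single _ _⟩, ?_⟩, sat_top⟩
    · rw [sat_alloc, Heap.single_val_self]
      exact Option.some_ne_none l
    · rw [sat_conj]
      simp only [List.mem_map, forall_exists_index, and_imp, forall_apply_eq_imp_iff₂]
      intro y hy
      rw [sat_neg, sat_pto, Heap.single_val_self, Option.some_inj]
      rintro rfl
      exact hl (List.mem_map_of_mem hy)
  | starIntro ψ _ ih =>
    intro s h
    rw [sat_imp, sat_star, sat_star]
    rintro ⟨h₁, h₂, hd, rfl, hs₁, hs₂⟩
    exact ⟨h₁, h₂, hd, rfl, sat_imp.1 (ih s h₁) hs₁, hs₂⟩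
  | starAdj _ ih =>
    intro s h
    rw [sat_imp, sat_wand]
    exact fun hφ h₁ hd h₁ψ => sat_imp.1 (ih s _) (sat_star.2 ⟨h, h₁, hd.symm, rfl, hφ, h₁ψ⟩)
  | wandAdj _ ih =>
    intro s h
    rw [sat_imp, sat_star]
    rintro ⟨h₁, h₂, hd, rfl, hs₁, hs₂⟩
    exact sat_wand.1 (sat_imp.1 (ih s h₁) hs₁) h₂ hd.symm hs₂

namespace Lind

variable {V : Type*} [DecidableEq V] [Inhabited V] {a b c q : Lind V}

theorem le_compl_iff_inf_le_bot : a ≤ bᶜ ↔ a ⊓ b ≤ ⊥ :=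
  le_compl_iff_disjoint_right.trans disjoint_iff_inf_le

theorem eq_bot_of_le_of_le_compl (h₁ : a ≤ b) (h₂ : a ≤ bᶜ) : a = ⊥ :=
  le_bot_iff.1 ((le_inf h₁ h₂).trans (inf_compl_self b).le)

theorem le_of_inf_compl_le (h : a ⊓ qᶜ ≤ q) : a ≤ q := by
  have := le_compl_iff_inf_le_bot.2 ((le_inf h inf_le_right).trans (inf_compl_self q).le)
  rwa [compl_compl] at this

/-! ### Equality types -/

variable {L : Type*} [DecidableEq L] (X : Finset V) (s : V → L)

/-- The equalities and disequalities between the variables of `X` that hold in the store `s`. -/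
def EqT : Lind V := X.inf fun x => X.inf fun y => if s x = s y then E x y else (E x y)ᶜ

variable {X s} {x y z : V} {l l' : L}

theorem le_EqT_iff :
    a ≤ EqT X s ↔ ∀ x ∈ X, ∀ y ∈ X, a ≤ if s x = s y then E x y else (E x y)ᶜ := by
  simp [EqT, Finset.le_inf_iff]

theorem EqT_le_E (hx : x ∈ X) (hy : y ∈ X) (h : s x = s y) : EqT X s ≤ E x y := by
  simpa [h] using le_EqT_iff.1 (le_refl (EqT X s)) x hx y hy

theorem EqT_le_E_compl (hx : x ∈ X) (hy : y ∈ X) (h : s x ≠ s y) : EqT X s ≤ (E x y)ᶜ := by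
  simpa [h] using le_EqT_iff.1 (le_refl (EqT X s)) x hx y hy

theorem hereditary_EqT : Hereditary (EqT X s) := by
  refine Hereditary.finset_inf _ fun x _ => Hereditary.finset_inf _ fun y _ => ?_
  split_ifs
  · exact hereditary_E x y
  · exact hereditary_E_compl x y

theorem EqT_mul_top : EqT X s * ⊤ ≤ EqT X s := by
  refine finset_inf_mul_top_le _ fun x _ => finset_inf_mul_top_le _ fun y _ => ?_
  split_ifs
  · exact E_mul_top x y
  · exact E_compl_mul_top x y

theorem mul_EqT_le (a : Lind V) : a * EqT X s ≤ EqT X s := by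
  rw [mul_comm]
  exact (mul_le_mul' le_rfl le_top).trans EqT_mul_top

/-- Equalities do not depend on the heap, so they pass to the extension and may be imposed on the
added part. -/
theorem EqT_inf_sept_le (a : Lind V) : EqT X s ⊓ sept a ⊤ ≤ sept (EqT X s ⊓ a) ⊤ := by
  rw [sept_top (EqT X s ⊓ a), le_compl_iff_inf_le_bot, inf_right_comm, sept_top,
    ← le_compl_iff_inf_le_bot, compl_compl, le_wand_iff]
  refine (le_inf ?_ le_rfl).trans ((hereditary_EqT _ a).trans
    ((mul_le_mul' (inf_le_right.trans inf_le_right) le_rfl).trans (wand_mul_le _ _)))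
  exact (mul_le_mul' inf_le_left le_top).trans EqT_mul_top

theorem le_EqT_insert (ha : a ≤ EqT X s)
    (h : ∀ y ∈ X, a ≤ if s x = s y then E x y else (E x y)ᶜ) : a ≤ EqT (insert x X) s := by
  rw [le_EqT_iff] at *
  intro y hy z hz
  rw [Finset.mem_insert] at hy hz
  rcases hy with rfl | hy <;> rcases hz with rfl | hz
  · simp [E_self]
  · exact h z hz
  · simpa [E_comm, eq_comm] using h y hy
  · exact ha y hy z hz

theorem EqT_congr {t : V → L} (h : ∀ x ∈ X, s x = t x) : EqT X s = EqT X t :=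
  eq_of_forall_le_iff fun a => by
    rw [le_EqT_iff, le_EqT_iff]
    exact forall₄_congr fun x hx y hy => by rw [h x hx, h y hy]

/-- Induction on `X`: a new variable equals an old one, whose value it then receives, or differs
from all of them and receives a fresh value. -/
theorem top_le_of_EqT_le [Infinite L] (X : Finset V) (h : ∀ s : V → L, EqT X s ≤ q) : ⊤ ≤ q := by
  induction X using Finset.induction_on with
  | empty =>
    obtain ⟨l⟩ : Nonempty L := inferInstance
    exact h fun _ => l
  | insert x X hx ih =>
    refine ih fun s => ?_
    have hs : ∀ l, EqT X s = EqT X (Function.update s x l) := fun l => EqT_congr fun y hy => by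
      rw [Function.update_of_ne (ne_of_mem_of_not_mem hy hx)]
    have key : ∀ y ∈ X, EqT X s ⊓ E x y ≤ q := by
      intro y hy
      refine le_trans (le_EqT_insert (inf_le_left.trans (hs (s y)).le) fun z hz => ?_)
        (h (Function.update s x (s y)))
      rw [Function.update_self, Function.update_of_ne (ne_of_mem_of_not_mem hz hx)]
      split_ifs with hyz
      · exact (inf_le_inf_right _ (EqT_le_E hy hz hyz)).trans ((inf_comm _ _).le.trans
          (E_trans x y z))
      · rw [le_compl_iff_inf_le_bot, E_comm x y, inf_assoc]
        exact (inf_le_inf (EqT_le_E_compl hy hz hyz) (E_trans y x z)).trans (compl_inf_self _).le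
    obtain ⟨l, hl⟩ := exists_fresh (X.image s).finite_toSet
    -- Assuming `qᶜ` rules out every equality of `x` with an old variable, by `key`; what remains is
    -- the case of a fresh value.
    refine le_of_inf_compl_le (le_trans (le_EqT_insert (inf_le_left.trans (hs l).le)
      fun z hz => ?_) (h (Function.update s x l)))
    rw [Function.update_self, Function.update_of_ne (ne_of_mem_of_not_mem hz hx), if_neg]
    · rw [le_compl_iff_inf_le_bot, inf_right_comm]
      exact (inf_le_inf_right _ (key z hz)).trans (inf_compl_self q).le
    · rintro rfl
      exact hl (Finset.mem_coe.2 (Finset.mem_image_of_mem s hz))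

/-! ### Single cells at named locations -/

variable (X s) in
open Classical in
/-- A variable of `X` with value `l`. -/
noncomputable def rep (l : L) : V := if h : ∃ x ∈ X, s x = l then h.choose else default

omit [DecidableEq V] in
theorem rep_spec (hl : l ∈ X.image s) : rep X s l ∈ X ∧ s (rep X s l) = l := by
  have h : ∃ x ∈ X, s x = l := by simpa using hl
  rw [rep, dif_pos h]
  exact h.choose_spec

omit [DecidableEq V] in
theorem rep_mem (hx : x ∈ X) : rep X s (s x) ∈ X :=
  (rep_spec (Finset.mem_image_of_mem s hx)).1

omit [DecidableEq V] in
theorem rep_val (hx : x ∈ X) : s (rep X s (s x)) = s x :=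
  (rep_spec (Finset.mem_image_of_mem s hx)).2

theorem EqT_inf_A_le (hx : x ∈ X) (hy : y ∈ X) (h : s x = s y) : EqT X s ⊓ A x ≤ A y :=
  (inf_le_inf_right _ (EqT_le_E hx hy h)).trans (E_inf_A_le x y)

theorem EqT_inf_A_compl_le (hx : x ∈ X) (hy : y ∈ X) (h : s x = s y) :
    EqT X s ⊓ (A x)ᶜ ≤ (A y)ᶜ := by
  rw [le_compl_iff_inf_le_bot, inf_right_comm]
  exact (inf_le_inf_right _ (EqT_inf_A_le hy hx h.symm)).trans (inf_compl_self _).le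

variable (X s) in
/-- The heap has the one cell `l ↦ l'`, as far as the variables of `X` can tell. -/
noncomputable def Cell (l l' : L) : Lind V :=
  EqT X s ⊓ Z V 1 ⊓ A (rep X s l) ⊓
    X.inf fun y => if s y = l' then P (rep X s l) y else (P (rep X s l) y)ᶜ

theorem Cell_le_EqT : Cell X s l l' ≤ EqT X s := inf_le_left.trans (inf_le_left.trans inf_le_left)

theorem Cell_le_Z : Cell X s l l' ≤ Z V 1 := inf_le_left.trans (inf_le_left.trans inf_le_right)

theorem Cell_le_A_rep : Cell X s l l' ≤ A (rep X s l) := inf_le_left.trans inf_le_right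

theorem Cell_le_A (hx : x ∈ X) : Cell X s (s x) l' ≤ A x :=
  (le_inf Cell_le_EqT Cell_le_A_rep).trans (EqT_inf_A_le (rep_mem hx) hx (rep_val hx))

/-- Two distinct allocated variables would force size at least two. -/
theorem Cell_le_A_compl (hl : l ∈ X.image s) (hx : x ∈ X) (h : s x ≠ l) :
    Cell X s l l' ≤ (A x)ᶜ := by
  obtain ⟨hr, hrl⟩ := rep_spec hl
  rw [le_compl_iff_inf_le_bot, ← compl_inf_self (S V 2)]
  refine le_inf (inf_le_left.trans (Cell_le_Z.trans inf_le_right)) ?_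
  refine le_trans (le_inf (inf_le_inf_right _ Cell_le_A_rep) ?_) (A_inf_A_le (rep X s l) x)
  exact inf_le_left.trans (Cell_le_EqT.trans (EqT_le_E_compl hr hx (by rw [hrl]; exact h.symm)))

theorem Cell_le_P (hx : x ∈ X) (hy : y ∈ X) : Cell X s (s x) (s y) ≤ P x y := by
  refine le_trans (le_inf Cell_le_EqT (inf_le_right.trans (Finset.inf_le hy))) ?_
  rw [if_pos rfl]
  exact (inf_le_inf_right _ (EqT_le_E (rep_mem hx) hx (rep_val hx))).trans (E_inf_P_le_left _ _ _)

theorem Cell_le_P_compl (hx : x ∈ X) (hy : y ∈ X) (h : s y ≠ l') :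
    Cell X s (s x) l' ≤ (P x y)ᶜ := by
  refine le_trans (le_inf Cell_le_EqT (inf_le_right.trans (Finset.inf_le hy))) ?_
  rw [if_neg h, le_compl_iff_inf_le_bot, inf_right_comm]
  exact (inf_le_inf_right _ ((inf_le_inf_right _ (EqT_le_E hx (rep_mem hx) (rep_val hx).symm)).trans
    (E_inf_P_le_left _ _ _))).trans (inf_compl_self _).le

theorem le_Cell_of_P (hy : y ∈ X) :
    EqT X s ⊓ Z V 1 ⊓ P (rep X s l) y ≤ Cell X s l (s y) := by
  refine le_inf (inf_le_inf_left _ (P_le_A _ _)) (Finset.le_inf fun z hz => ?_)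
  rw [inf_right_comm]
  refine inf_le_left.trans ?_
  split_ifs with h
  · exact (inf_le_inf_right _ (EqT_le_E hy hz h.symm)).trans (E_inf_P_le_right _ _ _)
  · rw [le_compl_iff_inf_le_bot, inf_assoc, ← compl_inf_self (E y z)]
    exact inf_le_inf (EqT_le_E_compl hy hz (Ne.symm h)) (P_inf_P_le _ _ _)

theorem le_Cell_of_forall (h : ∀ y ∈ X, s y ≠ l') :
    EqT X s ⊓ Z V 1 ⊓ A (rep X s l) ⊓ X.inf (fun y => (P (rep X s l) y)ᶜ) ≤ Cell X s l l' :=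
  inf_le_inf_left _ (Finset.le_inf fun y hy => by
    rw [if_neg (h y hy)]
    exact Finset.inf_le hy)

/-- The single cell points to the value of some variable of `X`, or to none of them; a fresh `k`
stands for the latter case. -/
theorem le_of_Cell_le [Infinite L] (h : ∀ l', Cell X s l l' ≤ q) :
    EqT X s ⊓ Z V 1 ⊓ A (rep X s l) ≤ q := by
  obtain ⟨k, hk⟩ := exists_fresh (X.image s).finite_toSet
  refine le_of_inf_compl_le (le_trans ?_ (h k))
  refine le_trans (le_inf inf_le_left (Finset.le_inf fun y hy => ?_)) (le_Cell_of_forall ?_)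
  · rw [le_compl_iff_inf_le_bot, ← compl_inf_self q]
    refine le_inf (inf_le_left.trans inf_le_right) ?_
    refine le_trans ?_ ((le_Cell_of_P hy).trans (h (s y)))
    exact inf_le_inf_right _ (inf_le_left.trans inf_le_left)
  · rintro y hy rfl
    exact hk (Finset.mem_coe.2 (Finset.mem_image_of_mem s hy))

/-- A target named by `X` is provided by `septPto`, an anonymous one by `septAlloc`. -/
theorem le_sept_Cell : EqT X s ⊓ (A (rep X s l))ᶜ ≤ sept (Cell X s l l') ⊤ := by
  by_cases h : ∃ y ∈ X, s y = l'
  · obtain ⟨y, hy, rfl⟩ := h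
    have h₁ : (A (rep X s l))ᶜ ≤ sept (P (rep X s l) y ⊓ Z V 1) ⊤ := Derivable.septPto _ y
    refine (inf_le_inf_left _ h₁).trans ((EqT_inf_sept_le _).trans (sept_mono ?_ le_rfl))
    rw [inf_comm (P _ _), ← inf_assoc]
    exact le_Cell_of_P hy
  · push Not at h
    have h₁ : (A (rep X s l))ᶜ ≤ sept (A (rep X s l) ⊓ Z V 1 ⊓
        mk (.conj (X.toList.map fun y => .neg (.pto (rep X s l) y)))) ⊤ :=
      Derivable.septAlloc _ _ X.nodup_toList
    refine (inf_le_inf_left _ h₁).trans ((EqT_inf_sept_le _).trans (sept_mono ?_ le_rfl))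
    refine le_trans (le_inf (le_inf (le_inf inf_le_left ?_) ?_) (Finset.le_inf fun y hy => ?_))
      (le_Cell_of_forall h)
    · exact inf_le_right.trans (inf_le_left.trans inf_le_right)
    · exact inf_le_right.trans (inf_le_left.trans inf_le_left)
    · exact inf_le_right.trans (inf_le_right.trans ((mk_conj _ _).1 le_rfl _
        (List.mem_map_of_mem (Finset.mem_toList.2 hy))))

variable (X s) in
/-- The contents of the heap at a named location. -/
noncomputable def CellO (l : L) : Option L → Lind V
  | none => 1
  | some l' => Cell X s l l'

theorem CellO_add {h₁ h₂ : Heap L} (hd : h₁.Disj h₂) (l : L) :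
    CellO X s l ((h₁.add h₂).val l) = CellO X s l (h₁.val l) * CellO X s l (h₂.val l) := by
  rcases Heap.disj_iff.1 hd l with h | h <;> simp [Heap.add_val, h, CellO]

theorem CellO_le_A_compl (hl : l ∈ X.image s) (hx : x ∈ X) (h : s x ≠ l) (o : Option L) :
    CellO X s l o ≤ (A x)ᶜ := by
  cases o with
  | none => exact one_le_A_compl x
  | some l' => exact Cell_le_A_compl hl hx h

/-! ### The anonymous part -/

variable (X) in
/-- None of the variables of `X` is allocated. -/
def U : Lind V := X.inf fun x => (A x)ᶜ

theorem hereditary_U : Hereditary (U X) :=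
  Hereditary.finset_inf _ fun x _ => hereditary_A_compl x

theorem U_mul_U : U X * U X ≤ U X := finset_inf_mul_le _ fun x _ => A_compl_mul x

theorem one_le_U : 1 ≤ U X := Finset.le_inf fun x _ => one_le_A_compl x

theorem U_le (hx : x ∈ X) : U X ≤ (A x)ᶜ := Finset.inf_le hx

variable (X s) in
/-- No variable of `X` is allocated, and there are `r` cells, up to the bound `m`. -/
def Rest (m r : ℕ) : Lind V := EqT X s ⊓ U X ⊓ Sz V m r

theorem Rest_mul_le (m r₁ r₂ : ℕ) :
    Rest X s m r₁ * Rest X s m r₂ ≤ Rest X s m (r₁ + r₂) := by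
  refine le_inf (le_inf ?_ ?_) ?_
  · exact (mul_le_mul' le_rfl (inf_le_left.trans inf_le_left)).trans (mul_EqT_le _)
  · exact (mul_le_mul' (inf_le_left.trans inf_le_right) (inf_le_left.trans inf_le_right)).trans
      U_mul_U
  · exact (mul_le_mul' inf_le_right inf_le_right).trans (Sz_mul_le _ _ _)

theorem Rest_le_mul (m r₁ r₂ : ℕ) :
    Rest X s (m + m) (r₁ + r₂) ≤ Rest X s m r₁ * Rest X s m r₂ :=
  (inf_le_inf_left _ (Sz_le_mul m r₁ r₂)).trans ((hereditary_EqT.inf hereditary_U) _ _)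

theorem sept_Z_one_eq_top : sept (Z V 1 ⊓ U X) ⊤ = ⊤ := by
  have h : sept (Z V 1 ⊓ mk (.conj (X.toList.map fun x => .neg (.alloc x)))) ⊤ = ⊤ :=
    mk_eq_top.2 (.septSize _ X.nodup_toList)
  refine top_le_iff.1 (h.ge.trans ?_)
  exact sept_mono (inf_le_inf_left _ (Finset.le_inf fun x hx => (mk_conj _ _).1 le_rfl _
    (List.mem_map_of_mem (Finset.mem_toList.2 hx)))) le_rfl

/-- Adding one anonymous cell is always possible by `septSize`; repeating this `r` times keeps `U
X`, which is closed under products. -/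
theorem EqT_le_sept_Rest (m r : ℕ) : EqT X s ≤ sept (Rest X s m r) ⊤ := by
  have h₁ : ∀ n, sept ((Z V 1 ⊓ U X) ^ n) ⊤ = ⊤ := by
    intro n
    induction n with
    | zero => rw [pow_zero, sept_one]
    | succ n ih => rw [pow_succ, sept_mul, sept_Z_one_eq_top, ih]
  have h₂ : ∀ n, (Z V 1 ⊓ U X) ^ n ≤ U X := by
    intro n
    induction n with
    | zero => rw [pow_zero]; exact one_le_U
    | succ n ih => rw [pow_succ]; exact (mul_le_mul' ih inf_le_right).trans U_mul_U
  have h₃ : (Z V 1 ⊓ U X) ^ r ≤ Sz V m r :=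
    (pow_le_pow_left' inf_le_left r).trans ((Z_one_pow_le r).trans (Z_le_Sz m r))
  have h₄ := EqT_inf_sept_le (X := X) (s := s) ((Z V 1 ⊓ U X) ^ r)
  rw [h₁, inf_top_eq] at h₄
  refine h₄.trans (sept_mono ?_ le_rfl)
  rw [Rest, inf_assoc]
  exact inf_le_inf_left _ (le_inf (h₂ r) h₃)

/-! ### Types of memory states -/

variable (X s) in
/-- The contents of the heap at the named locations. -/
noncomputable def Cells (h : Heap L) : Lind V := ∏ l ∈ X.image s, CellO X s l (h.val l)

variable (X s) in
/-- The number of anonymous cells. -/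
noncomputable def anon (h : Heap L) : ℕ := (h.dom \ X.image s).ncard

variable (X s) in
/-- The type of the memory state `(s, h)` with respect to the variables of `X` and the
bound `m` on the number of anonymous cells. -/
noncomputable def T (m : ℕ) (h : Heap L) : Lind V := Cells X s h * Rest X s m (anon X s h)

variable {m : ℕ} {h h₁ h₂ : Heap L}

theorem Cells_add (hd : h₁.Disj h₂) : Cells X s (h₁.add h₂) = Cells X s h₁ * Cells X s h₂ := by
  simp only [Cells, CellO_add hd, Finset.prod_mul_distrib]

omit [DecidableEq V] [Inhabited V] in
theorem anon_add (hd : h₁.Disj h₂) : anon X s (h₁.add h₂) = anon X s h₁ + anon X s h₂ := by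
  rw [anon, Heap.dom_add, Set.union_sdiff_distrib, Set.ncard_union_eq _ h₁.dom_finite.sdiff
    h₂.dom_finite.sdiff, anon, anon]
  exact (Set.disjoint_iff_inter_eq_empty.2 hd).mono Set.sdiff_subset Set.sdiff_subset

theorem T_mul_le (hd : h₁.Disj h₂) : T X s m h₁ * T X s m h₂ ≤ T X s m (h₁.add h₂) := by
  rw [T, T, T, Cells_add hd, anon_add hd, mul_mul_mul_comm]
  exact mul_le_mul' le_rfl (Rest_mul_le _ _ _)

theorem T_le_mul (hd : h₁.Disj h₂) :
    T X s (m + m) (h₁.add h₂) ≤ T X s m h₁ * T X s m h₂ := by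
  rw [T, T, T, Cells_add hd, anon_add hd, mul_mul_mul_comm]
  exact mul_le_mul' le_rfl (Rest_le_mul _ _ _)

theorem T_anti {n : ℕ} (hmn : m ≤ n) : T X s n h ≤ T X s m h :=
  mul_le_mul' le_rfl (inf_le_inf_left _ (Sz_anti hmn _))

/-! ### Atomic formulae settled by a type -/

theorem T_le_EqT : T X s m h ≤ EqT X s :=
  (mul_le_mul' le_rfl (inf_le_left.trans inf_le_left)).trans (mul_EqT_le _)

theorem T_le_of_CellO_le (hl : l ∈ X.image s) (hd : a * ⊤ ≤ a)
    (h' : CellO X s l (h.val l) ≤ a) : T X s m h ≤ a :=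
  (mul_le_mul' (prod_le_of_mem hl hd h') le_top).trans hd

theorem T_le_A (hx : x ∈ X) (hv : h.val (s x) ≠ none) : T X s m h ≤ A x := by
  obtain ⟨l', hl'⟩ := Option.ne_none_iff_exists'.1 hv
  refine T_le_of_CellO_le (Finset.mem_image_of_mem s hx) (A_mul_top x) ?_
  rw [hl']
  exact Cell_le_A hx

theorem T_le_A_compl (hx : x ∈ X) (hv : h.val (s x) = none) : T X s m h ≤ (A x)ᶜ := by
  refine (mul_le_mul' (prod_le_of_mul_le _ (one_le_A_compl x) (A_compl_mul x) fun l hl => ?_)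
    (inf_le_left.trans (inf_le_right.trans (U_le hx)))).trans (A_compl_mul x)
  rcases eq_or_ne (s x) l with rfl | hne
  · rw [hv]
    exact one_le_A_compl x
  · exact CellO_le_A_compl hl hx hne _

theorem T_le_P (hx : x ∈ X) (hy : y ∈ X) (hv : h.val (s x) = some (s y)) :
    T X s m h ≤ P x y := by
  refine T_le_of_CellO_le (Finset.mem_image_of_mem s hx) (P_mul_top x y) ?_
  rw [hv]
  exact Cell_le_P hx hy

/-- The axioms carry `¬ x ↪ y` from a part to the whole only when that part allocates `x`, hence the
conjunction. -/
theorem T_le_A_inf_P_compl (hx : x ∈ X) (hy : y ∈ X) (hv : h.val (s x) = some l')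
    (hl' : s y ≠ l') : T X s m h ≤ A x ⊓ (P x y)ᶜ := by
  have h₁ : (A x ⊓ (P x y)ᶜ) * ⊤ ≤ A x ⊓ (P x y)ᶜ :=
    le_inf ((mul_le_mul' inf_le_left le_rfl).trans (A_mul_top x)) (A_inf_P_compl_mul_top x y)
  refine T_le_of_CellO_le (Finset.mem_image_of_mem s hx) h₁ ?_
  rw [hv]
  exact le_inf (Cell_le_A hx) (Cell_le_P_compl hx hy hl')

theorem T_le_P_compl (hx : x ∈ X) (hy : y ∈ X) (hv : h.val (s x) ≠ some (s y)) :
    T X s m h ≤ (P x y)ᶜ := by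
  rcases hv' : h.val (s x) with _ | l'
  · exact (T_le_A_compl hx hv').trans (compl_le_compl (P_le_A x y))
  · exact (T_le_A_inf_P_compl hx hy hv' (by rintro rfl; exact hv hv')).trans inf_le_right

end Lind

namespace Lind

variable {V : Type*} [DecidableEq V] [Inhabited V] {a b c q : Lind V}
variable {L : Type*} [DecidableEq L] {X : Finset V} {s : V → L} {x y z : V} {l l' : L}
variable {m : ℕ} {h h₁ h₂ : Heap L}

/-! ### Every memory state has a type -/

omit [DecidableEq V] [Inhabited V] in
theorem exists_heap [Infinite L] (X : Finset V) (s : V → L) (f : L → Option L) (r : ℕ)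
    {F : Set L} (hF : F.Finite) : ∃ h : Heap L, (∀ l ∈ X.image s, h.val l = f l) ∧
      (∀ l ∉ X.image s, h.val l ≠ none → l ∉ F) ∧ anon X s h = r := by
  obtain ⟨D, hD, hr⟩ :=
    ((X.image s).finite_toSet.union hF).infinite_compl.exists_subset_card_eq r
  have hDX : ∀ l ∈ D, l ∉ X.image s ∧ l ∉ F := fun l hl => by
    simpa [not_or] using hD hl
  let h : Heap L :=
    ⟨fun l => if l ∈ X.image s then f l else if l ∈ D then some l else none,
      (X.image s ∪ D).finite_toSet.subset fun l hl => by
        by_contra hn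
        rw [Finset.mem_coe, Finset.mem_union, not_or] at hn
        exact hl (by simp only [if_neg hn.1, if_neg hn.2])⟩
  have hv : ∀ l ∉ X.image s, h.val l ≠ none ↔ l ∈ D := fun l hl => by
    by_cases hl' : l ∈ D <;> simp only [h, if_neg hl, hl', if_true, if_false] <;> simp
  refine ⟨h, fun l hl => if_pos hl, fun l hl hn => (hDX l ((hv l hl).1 hn)).2, ?_⟩
  rw [anon, ← hr, ← Set.ncard_coe_finset]
  congr 1
  ext l
  rw [Set.mem_sdiff, Heap.mem_dom, Finset.mem_coe, Finset.mem_coe]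
  exact ⟨fun hl => (hv l hl.2).1 hl.1, fun hl => ⟨(hv l (hDX l hl).1).2 hl, (hDX l hl).1⟩⟩

/-- Named locations are peeled off one at a time: either `l` is unallocated, or a single cell at `l`
splits off and the remainder does not allocate `l`. The target `q` varies in the induction because
the peeled cell is moved into it by residuation. -/
theorem EqT_le_of_prod_le [Infinite L] {M : Finset L} (hM : M ⊆ X.image s)
    (h : ∀ f : L → Option L, (∏ l ∈ M, CellO X s l (f l)) *
      (EqT X s ⊓ M.inf fun l => (A (rep X s l))ᶜ) ≤ q) : EqT X s ≤ q := by
  induction M using Finset.induction_on generalizing q with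
  | empty => simpa using h fun _ => none
  | insert l M hl ih =>
    have hlX : l ∈ X.image s := hM (by simp)
    obtain ⟨hr, hrl⟩ := rep_spec hlX
    have hMX : M ⊆ X.image s := fun k hk => hM (by simp [hk])
    have key : ∀ o, (EqT X s ⊓ (A (rep X s l))ᶜ) * CellO X s l o ≤ q := by
      intro o
      rw [← le_wand_iff, ← le_himp_iff]
      refine ih hMX fun f => ?_
      rw [le_himp_iff, le_wand_iff, inf_comm]
      refine (mul_le_mul' (hereditary_A_compl _ _ _) le_rfl).trans ?_
      have hf := h (Function.update f l o)
      rw [Finset.prod_insert hl, Function.update_self, Finset.inf_insert] at hf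
      refine le_trans ?_ hf
      rw [mul_comm, mul_assoc]
      refine mul_le_mul' le_rfl (mul_le_mul' (inf_le_right.trans_eq ?_) ?_)
      · exact Finset.prod_congr rfl fun k hk => by
          rw [Function.update_of_ne (ne_of_mem_of_not_mem hk hl)]
      · rw [inf_left_comm]
    have h₁ : EqT X s ⊓ (A (rep X s l))ᶜ ≤ q := by simpa [CellO] using key none
    have h₂ : EqT X s ⊓ Z V 1 ⊓ A (rep X s l) ≤ wand (EqT X s ⊓ (A (rep X s l))ᶜ) q :=
      le_of_Cell_le fun l' => by
        rw [le_wand_iff, mul_comm]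
        exact key (some l')
    have h₃ : EqT X s ⊓ A (rep X s l) ≤ q := by
      refine le_trans ?_ (le_wand_iff.1 h₂)
      refine (le_inf (inf_le_inf_left _ (A_le_mul_top _)) inf_le_right).trans ?_
      refine (inf_le_inf_right _ (hereditary_EqT _ _)).trans ?_
      rw [← inf_assoc, inf_top_eq, ← le_himp_iff]
      -- The remainder cannot allocate `l` again, since `A * A = ⊥`.
      refine mul_le_of_split_right (A (rep X s l)) ?_ ?_
      · refine ((mul_le_mul' (inf_le_left.trans inf_le_right) inf_le_left).trans
          (A_mul_A _).le).trans bot_le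
      · rw [le_himp_iff]
        refine inf_le_left.trans (mul_le_mul' ?_ (inf_comm _ _).le)
        rw [inf_assoc, inf_assoc, inf_comm (Z V 1)]
    calc EqT X s = EqT X s ⊓ A (rep X s l) ⊔ EqT X s ⊓ (A (rep X s l))ᶜ := by
          rw [← inf_sup_left, sup_compl_eq_top, inf_top_eq]
      _ ≤ q := sup_le h₃ h₁

theorem EqT_le_of_T_le [Infinite L] (m : ℕ) (h : ∀ h : Heap L, T X s m h ≤ q) :
    EqT X s ≤ q := by
  refine EqT_le_of_prod_le (Finset.Subset.refl _) fun f => ?_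
  have h₁ : EqT X s ⊓ ((X.image s).inf fun l => (A (rep X s l))ᶜ) ≤ EqT X s ⊓ U X := by
    refine le_inf inf_le_left (Finset.le_inf fun x hx => ?_)
    exact (inf_le_inf_left _ (Finset.inf_le (Finset.mem_image_of_mem s hx))).trans
      (EqT_inf_A_compl_le (rep_mem hx) hx (rep_val hx))
  refine (mul_le_mul' le_rfl h₁).trans ?_
  rw [mul_comm, ← le_wand_iff, ← top_inf_eq (EqT X s ⊓ U X), ← le_himp_iff]
  refine top_le_of_Sz_le (m := m) fun r => ?_
  rw [le_himp_iff, le_wand_iff]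
  -- Any choice `f` of named contents and any count `r` of anonymous cells come from an actual heap,
  -- so the hypothesis on types of heaps covers all cases.
  obtain ⟨k, hk, -, rfl⟩ := exists_heap X s f r Set.finite_empty
  refine le_trans ?_ (h k)
  rw [mul_comm, T, Rest, inf_comm (Sz _ _ _)]
  exact mul_le_mul' (Finset.prod_congr rfl fun l hl => by rw [hk l hl]).le le_rfl

/-! ### Extensions of the heap -/

/-- The cells are added one by one; a cell at `l` leaves the other named locations as they were, so
those still to be filled stay unallocated. -/
theorem le_sept_prod (hc : EqT X s ≤ sept c ⊤) {M : Finset L} (hM : M ⊆ X.image s)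
    (ha : a ≤ EqT X s) (hA : ∀ x ∈ X, s x ∈ M → h.val (s x) ≠ none → a ≤ (A x)ᶜ) :
    a ≤ sept ((∏ l ∈ M, CellO X s l (h.val l)) * c) ⊤ := by
  induction M using Finset.induction_on generalizing a with
  | empty => simpa using ha.trans hc
  | insert l M hl ih =>
    have hlX : l ∈ X.image s := hM (by simp)
    obtain ⟨hr, hrl⟩ := rep_spec hlX
    have hMX : M ⊆ X.image s := fun k hk => hM (by simp [hk])
    rw [Finset.prod_insert hl]
    rcases hv : h.val l with _ | l'
    · simp only [CellO, one_mul]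
      exact ih hMX ha fun x hx hxM => hA x hx (by simp [hxM])
    · rw [mul_assoc, sept_mul]
      refine le_sept ((le_inf ha (hA _ hr ?_ ?_)).trans le_sept_Cell) (ih hMX ?_ ?_)
      · simp [hrl]
      · simp [hrl, hv]
      · exact (mul_le_mul' le_rfl Cell_le_EqT).trans (mul_EqT_le _)
      · intro x hx hxM hxv
        refine (mul_le_mul' (hA x hx (by simp [hxM]) hxv) (Cell_le_A_compl hlX hx ?_)).trans
          (A_compl_mul x)
        exact ne_of_mem_of_not_mem hxM hl

theorem T_le_sept (n : ℕ) (hd : h₁.Disj h) : T X s m h ≤ sept (T X s n h₁) ⊤ := by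
  refine le_sept_prod (EqT_le_sept_Rest _ _) (Finset.Subset.refl _) T_le_EqT fun x hx _ hv => ?_
  exact T_le_A_compl hx ((Heap.disj_iff.1 hd (s x)).resolve_left hv)

theorem T_mul_T_eq_bot (hx : x ∈ X) (hv₁ : h₁.val (s x) ≠ none) (hv₂ : h₂.val (s x) ≠ none)
    (m n : ℕ) : T X s m h₁ * T X s n h₂ = ⊥ :=
  le_bot_iff.1 ((mul_le_mul' (T_le_A hx hv₁) (T_le_A hx hv₂)).trans (A_mul_A x).le)

/-- A clash at a named location would make the product `⊥`; anonymous cells can be moved away from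
the domain of `h` without changing the type. -/
theorem exists_disj_T_eq [Infinite L] (hne : T X s m h * T X s m h₁ ≠ ⊥) :
    ∃ h₂ : Heap L, h₂.Disj h ∧ T X s m h₂ = T X s m h₁ := by
  obtain ⟨h₂, hv, hf, hr⟩ := exists_heap X s h₁.val (anon X s h₁) h.dom_finite
  refine ⟨h₂, Heap.disj_iff.2 fun l => ?_, ?_⟩
  · by_cases hl : l ∈ X.image s
    · rw [hv l hl]
      by_contra hn
      rw [not_or] at hn
      obtain ⟨x, hx, rfl⟩ := Finset.mem_image.1 hl
      exact hne (T_mul_T_eq_bot hx hn.2 hn.1 m m)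
    · by_contra hn
      rw [not_or] at hn
      exact hf l hl hn.1 hn.2
  · rw [T, T, hr]
    congr 1
    exact Finset.prod_congr rfl fun l hl => by rw [hv l hl]

/-! ### Decompositions of the heap -/

variable (X s) in
/-- The number of allocated named locations. -/
def named (h : Heap L) : ℕ := ∑ l ∈ X.image s, if h.val l = none then 0 else 1

theorem Cells_le_Z : Cells X s h ≤ Z V (named X s h) := by
  rw [Z_eq_pow, named, ← Finset.prod_pow_eq_pow_sum]
  refine Finset.prod_le_prod' fun l _ => ?_
  rcases h.val l with _ | l'
  · simp [CellO]
  · simpa [CellO] using Cell_le_Z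

theorem T_le_Z_mul_Sz : T X s m h ≤ Z V (named X s h) * Sz V m (anon X s h) :=
  mul_le_mul' Cells_le_Z inf_le_right

/-- Since `a ≠ ⊥`, lower and upper size bounds on it must be compatible, which forces `r` to be
divisible into parts that agree with `r₁` and `r₂` up to `m`. Here `k` is the number of named cells,
common to both descriptions. -/
theorem exists_sizes {k r r₁ r₂ : ℕ} (hne : a ≠ ⊥) (ha : a ≤ Z V k * Sz V (m + m) r)
    (ha' : a ≤ Z V k * (Sz V m r₁ * Sz V m r₂)) :
    ∃ t₁ t₂, t₁ + t₂ = r ∧ Sz V m t₁ = Sz V m r₁ ∧ Sz V m t₂ = Sz V m r₂ := by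
  have hlt : ∀ {i j}, a ≤ S V i → a ≤ (S V j)ᶜ → i < j := by
    intro i j hi hj
    by_contra hij
    exact hne (eq_bot_of_le_of_le_compl (hi.trans (S_anti (not_lt.1 hij))) hj)
  have lower : a ≤ S V (k + min (m + m) r) := by
    rw [S_add]
    exact ha.trans (mul_le_mul' (Z_le_S k) (Sz_le_S _ _))
  have lower' : a ≤ S V (k + (min m r₁ + min m r₂)) := by
    rw [S_add, S_add]
    exact ha'.trans (mul_le_mul' (Z_le_S k) (mul_le_mul' (Sz_le_S _ _) (Sz_le_S _ _)))
  have upper : r < m + m → min m r₁ + min m r₂ ≤ r := by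
    intro hr
    rw [Sz_of_lt hr, ← Z_add] at ha
    have := hlt lower' (ha.trans inf_le_right)
    omega
  have upper' : r₁ < m → r₂ < m → min (m + m) r ≤ r₁ + r₂ := by
    intro hr₁ hr₂
    rw [Sz_of_lt hr₁, Sz_of_lt hr₂, ← Z_add, ← Z_add] at ha'
    have := hlt lower (ha'.trans inf_le_right)
    omega
  rcases lt_or_ge r₁ m with hr₁ | hr₁
  · refine ⟨r₁, r - r₁, by omega, rfl, ?_⟩
    rcases lt_or_ge r₂ m with hr₂ | hr₂
    · congr 1
      omega
    · rw [Sz_of_le hr₂, Sz_of_le (by omega)]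
  · rcases lt_or_ge r₂ m with hr₂ | hr₂
    · refine ⟨r - r₂, r₂, by omega, ?_, rfl⟩
      rw [Sz_of_le hr₁, Sz_of_le (by omega)]
    · refine ⟨m, r - m, by omega, ?_, ?_⟩
      · rw [Sz_of_le hr₁, Sz_of_le le_rfl]
      · rw [Sz_of_le hr₂, Sz_of_le (by omega)]

theorem Cell_congr {l'' : L} (h : ∀ y ∈ X, s y = l' ↔ s y = l'') :
    Cell X s l l' = Cell X s l l'' := by
  rw [Cell, Cell]
  congr 1
  exact Finset.inf_congr rfl fun y hy => by simp only [h y hy]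

/-- The cell of a part of a heap at a named location agrees with that of the whole heap. -/
theorem CellO_eq_of_T_inf_ne_bot {n : ℕ} (hne : T X s n h ⊓ (T X s m h₁ * b) ≠ ⊥)
    (hx : x ∈ X) {l'' : L} (hv : h.val (s x) = some l') (hv₁ : h₁.val (s x) = some l'') :
    Cell X s (s x) l' = Cell X s (s x) l'' := by
  refine Cell_congr fun y hy => ⟨?_, ?_⟩
  · rintro rfl
    by_contra hn
    refine hne (eq_bot_of_le_of_le_compl (inf_le_left.trans (T_le_P hx hy hv))
      (inf_le_right.trans ?_))
    exact (mul_le_mul' (T_le_A_inf_P_compl hx hy hv₁ hn) le_top).trans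
      (A_inf_P_compl_mul_top x y)
  · rintro rfl
    by_contra hn
    refine hne (eq_bot_of_le_of_le_compl (inf_le_right.trans ?_)
      (inf_le_left.trans ((T_le_A_inf_P_compl hx hy hv hn).trans inf_le_right)))
    exact (mul_le_mul' (T_le_P hx hy hv₁) le_top).trans (P_mul_top x y)

theorem val_eq_none_iff_of_T_inf_ne_bot {n : ℕ}
    (hne : T X s n h ⊓ (T X s m h₁ * T X s m h₂) ≠ ⊥) (hx : x ∈ X) :
    h.val (s x) = none ↔ h₁.val (s x) = none ∧ h₂.val (s x) = none := by
  constructor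
  · intro hv
    have hA : T X s n h ⊓ (T X s m h₁ * T X s m h₂) ≤ (A x)ᶜ :=
      inf_le_left.trans (T_le_A_compl hx hv)
    constructor
    · by_contra hv'
      refine hne (eq_bot_of_le_of_le_compl (inf_le_right.trans ?_) hA)
      exact (mul_le_mul' (T_le_A hx hv') le_top).trans (A_mul_top x)
    · by_contra hv'
      refine hne (eq_bot_of_le_of_le_compl (inf_le_right.trans ?_) hA)
      rw [mul_comm]
      exact (mul_le_mul' (T_le_A hx hv') le_top).trans (A_mul_top x)
  · rintro ⟨hv₁, hv₂⟩
    by_contra hv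
    exact hne (eq_bot_of_le_of_le_compl (inf_le_left.trans (T_le_A hx hv))
      (inf_le_right.trans ((mul_le_mul' (T_le_A_compl hx hv₁) (T_le_A_compl hx hv₂)).trans
        (A_compl_mul x))))

theorem exists_split_T_eq (hne : T X s (m + m) h ⊓ (T X s m h₁ * T X s m h₂) ≠ ⊥) :
    ∃ k₁ k₂ : Heap L, k₁.Disj k₂ ∧ k₁.add k₂ = h ∧ T X s m k₁ = T X s m h₁ ∧
      T X s m k₂ = T X s m h₂ := by
  have hnone := fun x hx => val_eq_none_iff_of_T_inf_ne_bot (x := x) hne hx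
  have hor : ∀ x ∈ X, h₁.val (s x) = none ∨ h₂.val (s x) = none := by
    intro x hx
    by_contra hn
    rw [not_or] at hn
    exact hne (le_bot_iff.1 (inf_le_right.trans (T_mul_T_eq_bot hx hn.1 hn.2 m m).le))
  have hnamed : named X s h = named X s h₁ + named X s h₂ := by
    rw [named, named, named, ← Finset.sum_add_distrib]
    refine Finset.sum_congr rfl fun l hl => ?_
    obtain ⟨x, hx, rfl⟩ := Finset.mem_image.1 hl
    simp only [hnone x hx]
    rcases hor x hx with hv | hv <;> simp [hv]
  obtain ⟨t₁, t₂, ht, hS₁, hS₂⟩ := exists_sizes hne (inf_le_left.trans T_le_Z_mul_Sz)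
    (inf_le_right.trans ((mul_le_mul' T_le_Z_mul_Sz T_le_Z_mul_Sz).trans_eq (by
      rw [mul_mul_mul_comm, ← Z_add, ← hnamed])))
  obtain ⟨D, hD, hDt⟩ := Set.exists_subset_card_eq (s := h.dom \ X.image s) (n := t₁)
    (by change t₁ ≤ anon X s h; omega)
  -- The first part takes the named locations allocated in `h₁`, together with `t₁` anonymous
  -- locations of `h`.
  set p : Set L := {l | l ∈ X.image s ∧ h₁.val l ≠ none} ∪ D with hp
  have hmem : ∀ x ∈ X, s x ∈ p ↔ h₁.val (s x) ≠ none := by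
    intro x hx
    have hsx := Finset.mem_image_of_mem s hx
    have hsD : s x ∉ D := fun hs => (hD hs).2 hsx
    rw [hp, Set.mem_union, or_iff_left hsD]
    exact ⟨And.right, fun hv => ⟨hsx, hv⟩⟩
  have hC₁ : Cells X s (h.restrict p) = Cells X s h₁ := by
    refine Finset.prod_congr rfl fun l hl => ?_
    obtain ⟨x, hx, rfl⟩ := Finset.mem_image.1 hl
    by_cases hv₁ : h₁.val (s x) = none
    · rw [hv₁, Heap.restrict_val_of_notMem (by simp [hmem x hx, hv₁])]
    · rw [Heap.restrict_val_of_mem ((hmem x hx).2 hv₁)]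
      obtain ⟨l', hl'⟩ := Option.ne_none_iff_exists'.1 (fun hv => hv₁ ((hnone x hx).1 hv).1)
      obtain ⟨l'', hl''⟩ := Option.ne_none_iff_exists'.1 hv₁
      rw [hl', hl'']
      exact CellO_eq_of_T_inf_ne_bot hne hx hl' hl''
  have hC₂ : Cells X s (h.restrict pᶜ) = Cells X s h₂ := by
    refine Finset.prod_congr rfl fun l hl => ?_
    obtain ⟨x, hx, rfl⟩ := Finset.mem_image.1 hl
    by_cases hv₂ : h₂.val (s x) = none
    · rw [hv₂]
      by_cases hv₁ : h₁.val (s x) = none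
      · rw [Heap.restrict_val_of_mem (by simp [hmem x hx, hv₁]), (hnone x hx).2 ⟨hv₁, hv₂⟩]
      · rw [Heap.restrict_val_of_notMem (by simp [hmem x hx, hv₁])]
    · have hv₁ := (hor x hx).resolve_right hv₂
      rw [Heap.restrict_val_of_mem (by simp [hmem x hx, hv₁])]
      obtain ⟨l', hl'⟩ := Option.ne_none_iff_exists'.1 (fun hv => hv₂ ((hnone x hx).1 hv).2)
      obtain ⟨l'', hl''⟩ := Option.ne_none_iff_exists'.1 hv₂
      rw [hl', hl'']
      rw [mul_comm] at hne
      exact CellO_eq_of_T_inf_ne_bot hne hx hl' hl''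
  have hr₁ : anon X s (h.restrict p) = t₁ := by
    rw [anon, Heap.dom_restrict, ← hDt]
    congr 1
    ext l
    constructor
    · rintro ⟨⟨hl | hl, -⟩, hlX⟩
      · exact absurd hl.1 hlX
      · exact hl
    · exact fun hl => ⟨⟨.inr hl, (hD hl).1⟩, (hD hl).2⟩
  have hr₂ : anon X s (h.restrict pᶜ) = t₂ := by
    have := anon_add (X := X) (s := s) (h.restrict_disj p)
    rw [Heap.restrict_add] at this
    omega
  refine ⟨_, _, h.restrict_disj p, h.restrict_add p, ?_, ?_⟩
  · rw [T, T, hC₁, hr₁, Rest, hS₁, Rest]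
  · rw [T, T, hC₂, hr₂, Rest, hS₂, Rest]

/-! ### Types decide formulae -/

variable (X s) in
/-- The types with bound `m` decide the formula `φ`. -/
def Decides (m : ℕ) (φ : Formula V) : Prop :=
  ∀ h : Heap L, (Sat s h φ → T X s m h ≤ mk φ) ∧ (¬ Sat s h φ → T X s m h ≤ (mk φ)ᶜ)

theorem Decides.mono {n : ℕ} {φ : Formula V} (hφ : Decides X s m φ) (hmn : m ≤ n) :
    Decides X s n φ :=
  fun h => ⟨fun hs => (T_anti hmn).trans ((hφ h).1 hs), fun hs => (T_anti hmn).trans ((hφ h).2 hs)⟩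

theorem Decides.sat_of_T_eq {φ : Formula V} (hφ : Decides X s m φ) (hT : T X s m h = T X s m h₁)
    (hne : T X s m h ≠ ⊥) (hs : Sat s h₁ φ) : Sat s h φ := by
  by_contra hn
  exact hne (eq_bot_of_le_of_le_compl (hT.le.trans ((hφ h₁).1 hs)) ((hφ h).2 hn))

/-- Under `EqT X s`, a decided formula acts as the join of the types of its models, so upper bounds
can be checked on those types alone. -/
theorem Decides.EqT_inf_le [Infinite L] {φ : Formula V} (hφ : Decides X s m φ)
    (hq : ∀ h : Heap L, Sat s h φ → T X s m h ≤ q) : EqT X s ⊓ mk φ ≤ q := by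
  rw [← le_himp_iff]
  refine EqT_le_of_T_le m fun h => ?_
  rw [le_himp_iff]
  by_cases hs : Sat s h φ
  · exact inf_le_left.trans (hq h hs)
  · exact (inf_le_inf_right _ ((hφ h).2 hs)).trans ((compl_inf_self _).le.trans bot_le)

theorem Decides.star [Infinite L] {φ ψ : Formula V} (hφ : Decides X s m φ)
    (hψ : Decides X s m ψ) : Decides X s (m + m) (.star φ ψ) := by
  refine fun h => ⟨fun hs => ?_, fun hs => ?_⟩
  · obtain ⟨h₁, h₂, hd, rfl, hs₁, hs₂⟩ := sat_star.1 hs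
    exact (T_le_mul hd).trans (mul_le_mul' ((hφ h₁).1 hs₁) ((hψ h₂).1 hs₂))
  · have key : ∀ h₁ h₂ : Heap L, Sat s h₁ φ → Sat s h₂ ψ →
        T X s m h₁ * T X s m h₂ ≤ (T X s (m + m) h)ᶜ := by
      intro h₁ h₂ hs₁ hs₂
      rw [le_compl_iff_inf_le_bot, inf_comm, le_bot_iff]
      by_contra hne
      obtain ⟨k₁, k₂, hd, rfl, hk₁, hk₂⟩ := exists_split_T_eq hne
      refine hs (sat_star.2 ⟨k₁, k₂, hd, rfl, hφ.sat_of_T_eq hk₁ ?_ hs₁,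
        hψ.sat_of_T_eq hk₂ ?_ hs₂⟩)
      · rw [hk₁]
        intro hb
        exact hne (by rw [hb, bot_mul, inf_bot_eq])
      · rw [hk₂]
        intro hb
        exact hne (by rw [hb, mul_bot, inf_bot_eq])
    have h₁ : (EqT X s ⊓ mk φ) * (EqT X s ⊓ mk ψ) ≤ (T X s (m + m) h)ᶜ := by
      refine le_wand_iff.1 (hφ.EqT_inf_le fun h₁ hs₁ => ?_)
      rw [le_wand_iff, mul_comm]
      refine le_wand_iff.1 (hψ.EqT_inf_le fun h₂ hs₂ => ?_)
      rw [le_wand_iff, mul_comm]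
      exact key h₁ h₂ hs₁ hs₂
    rw [mk_star, le_compl_iff_inf_le_bot]
    calc T X s (m + m) h ⊓ (mk φ * mk ψ)
        ≤ T X s (m + m) h ⊓ (T X s (m + m) h)ᶜ := le_inf inf_le_left
          ((inf_le_inf_right _ T_le_EqT).trans ((hereditary_EqT _ _).trans h₁))
      _ ≤ ⊥ := (inf_compl_self _).le

theorem Decides.wand [Infinite L] {φ ψ : Formula V} (hφ : Decides X s m φ)
    (hψ : Decides X s m ψ) : Decides X s m (.wand φ ψ) := by
  refine fun h => ⟨fun hs => ?_, fun hs => ?_⟩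
  · rw [sat_wand] at hs
    have h₁ : EqT X s ⊓ mk φ ≤ Lind.wand (T X s m h) (mk ψ) := by
      refine hφ.EqT_inf_le fun h₁ hs₁ => ?_
      rw [le_wand_iff, mul_comm]
      by_cases hne : T X s m h * T X s m h₁ = ⊥
      · exact hne.le.trans bot_le
      · obtain ⟨h₂, hd, hT⟩ := exists_disj_T_eq hne
        have hs₂ : Sat s h₂ φ := hφ.sat_of_T_eq hT (by
          rw [hT]
          intro hb
          exact hne (by rw [hb, mul_bot])) hs₁
        rw [← hT]
        exact (T_mul_le hd.symm).trans ((hψ _).1 (hs h₂ hd hs₂))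
    rw [mk_wand, le_wand_iff]
    have h₂ := le_wand_iff.1 h₁
    rw [mul_comm] at h₂
    refine le_trans (le_inf ?_ le_rfl) ((hereditary_EqT _ _).trans
      ((mul_le_mul' inf_le_right le_rfl).trans h₂))
    exact (mul_le_mul' T_le_EqT le_top).trans EqT_mul_top
  · rw [sat_wand] at hs
    push Not at hs
    obtain ⟨h₁, hd, hs₁, hs₂⟩ := hs
    -- The semantic counterexample `h₁` becomes an extension in the algebra: it exists by
    -- `T_le_sept`, and the resulting type refutes `ψ`.
    have h₂ : T X s m h ≤ sept (mk φ) (mk ψ)ᶜ :=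
      (le_sept (T_le_sept m hd) ((T_mul_le hd.symm).trans ((hψ _).2 hs₂))).trans
        (sept_mono ((hφ h₁).1 hs₁) le_rfl)
    rwa [sept, compl_compl] at h₂

/-- Bound `1` is what separates no anonymous cell from at least one. -/
theorem decides_emp : Decides X s 1 .emp := by
  have hlow : ∀ h : Heap L, T X s 1 h ≤ S V (named X s h + min 1 (anon X s h)) := fun h => by
    rw [S_add]
    exact T_le_Z_mul_Sz.trans (mul_le_mul' (Z_le_S _) (Sz_le_S _ _))
  refine fun h => ⟨fun hs => ?_, fun hs => ?_⟩
  · rw [sat_emp] at hs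
    have hv : ∀ l, h.val l = none := fun l => by
      by_contra hl
      exact Set.notMem_empty l (hs ▸ Heap.mem_dom.2 hl)
    have h₁ := T_le_Z_mul_Sz (X := X) (s := s) (m := 1) (h := h)
    rwa [show named X s h = 0 by simp [named, hv], show anon X s h = 0 by simp [anon, hs],
      Sz_of_lt one_pos, Z_zero, mul_one] at h₁
  · rw [sat_emp] at hs
    obtain ⟨l, hl⟩ := Set.nonempty_iff_ne_empty.2 hs
    rw [mk_emp, ← S_one_compl, compl_compl]
    refine (hlow h).trans (S_anti ?_)
    by_cases hlX : l ∈ X.image s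
    · have : 1 ≤ named X s h := by
        have := Finset.single_le_sum (f := fun l => if h.val l = none then 0 else 1)
          (fun _ _ => Nat.zero_le _) hlX
        rwa [if_neg hl] at this
      omega
    · have : 0 < anon X s h :=
        (Set.ncard_pos h.dom_finite.sdiff).2 ⟨l, hl, by simpa using hlX⟩
      omega

end Lind

/-- The finite set of the variables of a formula. -/
def Formula.vars {V : Type*} [DecidableEq V] : Formula V → Finset V
  | eq x y => {x, y}
  | pto x y => {x, y}
  | emp => ∅
  | neg φ => vars φ
  | and φ ψ => vars φ ∪ vars ψ
  | star φ ψ => vars φ ∪ vars ψ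
  | wand φ ψ => vars φ ∪ vars ψ

/-! ### A bound deciding each formula -/

open Lind

theorem exists_decides {V : Type*} [DecidableEq V] [Inhabited V] {L : Type*} [DecidableEq L]
    [Infinite L] {X : Finset V} (s : V → L) (φ : Formula V) (hX : φ.vars ⊆ X) :
    ∃ m, Decides X s m φ := by
  induction φ with
  | eq x y =>
    have hx : x ∈ X := hX (by simp [Formula.vars])
    have hy : y ∈ X := hX (by simp [Formula.vars])
    exact ⟨0, fun h => ⟨fun hs => T_le_EqT.trans (EqT_le_E hx hy (sat_eq.1 hs)),
      fun hs => T_le_EqT.trans (EqT_le_E_compl hx hy (mt sat_eq.2 hs))⟩⟩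
  | pto x y =>
    have hx : x ∈ X := hX (by simp [Formula.vars])
    have hy : y ∈ X := hX (by simp [Formula.vars])
    exact ⟨0, fun h => ⟨fun hs => T_le_P hx hy (sat_pto.1 hs),
      fun hs => T_le_P_compl hx hy (mt sat_pto.2 hs)⟩⟩
  | emp => exact ⟨1, decides_emp⟩
  | neg φ ih =>
    obtain ⟨m, hm⟩ := ih hX
    refine ⟨m, fun h => ?_⟩
    rw [sat_neg, not_not, mk_neg, compl_compl]
    exact ⟨(hm h).2, (hm h).1⟩
  | and φ ψ ih₁ ih₂ =>
    obtain ⟨m, hm⟩ := ih₁ (Finset.union_subset_left hX)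
    obtain ⟨n, hn⟩ := ih₂ (Finset.union_subset_right hX)
    have hm' := hm.mono (le_max_left m n)
    have hn' := hn.mono (le_max_right m n)
    refine ⟨max m n, fun h => ?_⟩
    rw [sat_and, mk_and, compl_inf]
    refine ⟨fun hs => le_inf ((hm' h).1 hs.1) ((hn' h).1 hs.2), fun hs => ?_⟩
    rcases not_and_or.1 hs with hs | hs
    · exact ((hm' h).2 hs).trans le_sup_left
    · exact ((hn' h).2 hs).trans le_sup_right
  | star φ ψ ih₁ ih₂ =>
    obtain ⟨m, hm⟩ := ih₁ (Finset.union_subset_left hX)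
    obtain ⟨n, hn⟩ := ih₂ (Finset.union_subset_right hX)
    exact ⟨_, (hm.mono (le_max_left m n)).star (hn.mono (le_max_right m n))⟩
  | wand φ ψ ih₁ ih₂ =>
    obtain ⟨m, hm⟩ := ih₁ (Finset.union_subset_left hX)
    obtain ⟨n, hn⟩ := ih₂ (Finset.union_subset_right hX)
    exact ⟨_, (hm.mono (le_max_left m n)).wand (hn.mono (le_max_right m n))⟩

/-! ### Completeness -/

theorem Valid.derivable {V : Type*} [DecidableEq V] [Inhabited V] {L : Type*} [Infinite L]
    {φ : Formula V} (hφ : Valid L φ) : Derivable φ := by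
  classical
  refine mk_eq_top.1 (top_le_iff.1 (top_le_of_EqT_le (L := L) φ.vars fun s => ?_))
  obtain ⟨m, hm⟩ := exists_decides s φ (Finset.Subset.refl _)
  exact EqT_le_of_T_le m fun h => (hm h).1 (hφ s h)

end SepLogic

/-- The proof system is sound and complete for quantifier-free separation logic over memory
states: a formula is derivable if and only if it is valid. -/
theorem mainTheorem1 {V : Type*} [DecidableEq V] [Inhabited V] [Countable V] [Infinite V]
    {L : Type*} [Countable L] [Infinite L] :
    (∀ φ : SepLogic.Formula V, SepLogic.Derivable φ → SepLogic.Valid L φ) ∧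
      (∀ φ : SepLogic.Formula V, SepLogic.Valid L φ → SepLogic.Derivable φ) :=
  ⟨fun _ => SepLogic.Derivable.valid, fun _ => SepLogic.Valid.derivable⟩
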